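/- Notation. For a partition $\mu\vdash n$ let $\chi^\mu$ be the irreducible character of $\mathfrak S_n$ indexed by $\mu$ (the character of the Specht module $S^\mu$, so $\chi^{(n)}$ is trivial), let $\epsilon^\mu=\mathrm{sgn}\uparrow_{\mathfrak S_\mu}^{\mathfrak S_n}$ be the induced sign character, and let $m_\mu$ be the monomial symmetric function. Extend functions on $\mathfrak S_n$ linearly to $\mathbb Q[\mathfrak S_n]$, and for $D\in\mathbb Q[\mathfrak S_n]$ put $Y(D)=\sum_{\mu\vdash n}\epsilon^\mu(D)\,m_\mu$. For a simple graph $G$ on $n$ vertices let $X_G=\sum_{\mu\vdash n}c(G,\mu)\,m_\mu$ be its chromatic symmetric function, where $c(G,\mu)$ is the number of proper colorings of $G$ with exactly $\mu_i$ vertices of color $i$ for all $i$. Define $\theta(G)=\theta(D)$, where $D\in\mathbb Q[\mathfrak S_n]$ is any element with $Y(D)=X_G$. For an $n$-element poset $P$ let $\mathrm{inc}(P)$ be the graph on $P$ whose edges are the pairs of incomparable elements. A $P$-tableau of shape $\mu\vdash n$ is a filling of the Young diagram of $\mu$ with the elements of $P$, each used exactly once; write $T_{i,j}$ for the entry in row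 $i$ and column $j$, where row $1$ is the longest row. It is standard if $T_{i,j}<_P T_{i+1,j}$ whenever both boxes exist, and $T_{i,j}>_P T_{i,j+1}$ never holds. Write $k1^{n-k}$ for the hook partition $(k,1,\dots,1)$ of $n$. Lemma. Let $P$ be a naturally labeled $n$-element poset (its elements are labeled bijectively by $1,\dots,n$ so that $x<_P y$ implies that the label of $x$ is less than the label of $y$), and let $2\le k\le n$. Then there is an element $D\in\mathbb Q[\mathfrak S_n]$ with $Y(D)=X_{\mathrm{inc}(P)}$, the numbers $\chi^{k1^{n-k}}(\mathrm{inc}(P))$ and $\chi^{(k-1)1^{n-k+1}}(\mathrm{inc}(P))$ do not depend on its choice, and $$(k-1)\,\chi^{k1^{n-k}}(\mathrm{inc}(P))\;\ge\;(n-k+1)\,\chi^{(k-1)1^{n-k+1}}(\mathrm{inc}(P)).$$ Furthermore, the difference $(k-1)\,\chi^{k1^{n-k}}(\mathrm{inc}(P))-(n-k+1)\,\chi^{(k-1)1^{n-k+1}}(\mathrm{inc}(P))$ equals the number of standard $P$-tableaux of shape $k1^{n-k}$ in which one entry of the first row is marked and is incomparable in $P$ to an entry in an earlier column of the tableau. 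-/

import Mathlib

noncomputable section

namespace ChromTrace

/-- The parts of a partition, listed in weakly decreasing order. -/
def rowList {n : ℕ} (μ : n.Partition) : List ℕ := μ.parts.sort (· ≥ ·)

theorem rowList_sortedGE {n : ℕ} (μ : n.Partition) : (rowList μ).SortedGE :=
  (Multiset.pairwise_sort μ.parts (· ≥ ·)).sortedGE

/-- The composition `(μ₁, μ₂, …, μ_ℓ)` of `n` given by the weakly decreasing parts of `μ`. Its
`i`-th block is the interval `{μ₁ + ⋯ + μ_{i-1} + 1, …, μ₁ + ⋯ + μ_i}` of `[n]`. -/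
def comp {n : ℕ} (μ : n.Partition) : Composition n where
  blocks := rowList μ
  blocks_pos := by
    intro i hi
    exact μ.parts_pos ((Multiset.mem_sort (r := (· ≥ ·))).1 hi)
  blocks_sum := by
    have h : ((rowList μ : List ℕ) : Multiset ℕ).sum = n := by
      rw [rowList, Multiset.sort_eq, μ.parts_sum]
    simpa using h

/-- The hook partition `k 1^{n-k}` of `n`. -/
def hook (n k : ℕ) (hk : 1 ≤ k) (hkn : k ≤ n) : n.Partition where
  parts := k ::ₘ Multiset.replicate (n - k) 1
  parts_pos := by
    intro i hi
    rcases Multiset.mem_cons.1 hi with h | h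
    · omega
    · rw [Multiset.eq_of_mem_replicate h]; exact Nat.one_pos
  parts_sum := by
    simp only [Multiset.sum_cons, Multiset.sum_replicate, smul_eq_mul]
    omega

/-! ### Functions on the symmetric group and their linear extensions -/

/-- The group algebra `ℚ[𝔖_n]`. -/
abbrev GroupAlg (n : ℕ) : Type := MonoidAlgebra ℚ (Equiv.Perm (Fin n))

/-- The value `θ(D) = ∑_w D_w θ(w)` of the linear extension of `θ : 𝔖_n → ℚ` at `D ∈ ℚ[𝔖_n]`. -/
def evalAlg {n : ℕ} (θ : Equiv.Perm (Fin n) → ℚ) (D : GroupAlg n) : ℚ :=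
  ∑ w, D.coeff w * θ w

/-- The permutations of `{0, …, n-1}` that preserve a function `f`, i.e. map each fibre of `f`
to itself. -/
def fiberSubgroup {n : ℕ} {β : Type*} (f : Fin n → β) : Subgroup (Equiv.Perm (Fin n)) where
  carrier := {w | ∀ i, f (w i) = f i}
  mul_mem' := by
    intro a b ha hb i
    rw [Equiv.Perm.mul_apply, ha, hb]
  one_mem' := fun _ => rfl
  inv_mem' := by
    intro a ha i
    have h := ha (a⁻¹ i)
    have h' : a (a⁻¹ i) = i := Equiv.apply_symm_apply a i
    rw [h'] at h
    exact h.symm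

/-- The row (counted from `0`) of the box occupied by `i` in the Young tableau of shape `μ` whose
rows are filled successively with `0, 1, …, n-1`. -/
def rowOf {n : ℕ} (μ : n.Partition) (i : Fin n) : ℕ := (comp μ).index i

/-- The column (counted from `0`) of the box occupied by `i` in the same tableau. -/
def colOf {n : ℕ} (μ : n.Partition) (i : Fin n) : ℕ := (comp μ).invEmbedding i

/-- The Young subgroup `𝔖_μ`; it is also the row group of the tableau above. -/
def youngSubgroup {n : ℕ} (μ : n.Partition) : Subgroup (Equiv.Perm (Fin n)) :=
  fiberSubgroup (rowOf μ)

/-- The column group of the tableau above. -/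
def columnSubgroup {n : ℕ} (μ : n.Partition) : Subgroup (Equiv.Perm (Fin n)) :=
  fiberSubgroup (colOf μ)

open Classical in
/-- The function on `G` induced from a function `f` on a subgroup `H` (where `f` is given on all
of `G`, and only its values on `H` are used): `w ↦ |H|⁻¹ ∑_{g ∈ G, g⁻¹wg ∈ H} f(g⁻¹wg)`. -/
def inducedFun {G : Type*} [Group G] [Fintype G] (H : Subgroup G) (f : G → ℚ) (w : G) : ℚ :=
  (Nat.card H : ℚ)⁻¹ * ∑ g : G, if g⁻¹ * w * g ∈ H then f (g⁻¹ * w * g) else 0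

/-- The induced sign character `ε^μ = sgn ↑_{𝔖_μ}^{𝔖_n}`. -/
def epsilonChar {n : ℕ} (μ : n.Partition) : Equiv.Perm (Fin n) → ℚ :=
  inducedFun (youngSubgroup μ) fun w => ((Equiv.Perm.sign w : ℤ) : ℚ)

open Classical in
/-- The row symmetrizer `∑_{p ∈ R} p`. -/
def rowSymmetrizer {n : ℕ} (μ : n.Partition) : GroupAlg n :=
  ∑ p : Equiv.Perm (Fin n), if p ∈ youngSubgroup μ then MonoidAlgebra.single p 1 else 0

open Classical in
/-- The column antisymmetrizer `∑_{q ∈ C} sgn(q) q`. -/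
def columnAntisymmetrizer {n : ℕ} (μ : n.Partition) : GroupAlg n :=
  ∑ q : Equiv.Perm (Fin n), if q ∈ columnSubgroup μ then
    MonoidAlgebra.single q ((Equiv.Perm.sign q : ℤ) : ℚ) else 0

/-- The Young symmetrizer (column antisymmetrizer times row symmetrizer). -/
def youngSymmetrizer {n : ℕ} (μ : n.Partition) : GroupAlg n :=
  columnAntisymmetrizer μ * rowSymmetrizer μ

/-- The Specht module `S^μ`, realised as the left ideal of `ℚ[𝔖_n]` generated by the Young
symmetrizer. Identifying `ℚ[𝔖_n] · rowSymmetrizer` with the span of the tabloids of shape `μ`, it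
is the span of the polytabloids. -/
def spechtModule {n : ℕ} (μ : n.Partition) : Submodule ℚ (GroupAlg n) :=
  LinearMap.range (LinearMap.mulRight ℚ (youngSymmetrizer μ))

theorem mul_mem_spechtModule {n : ℕ} (μ : n.Partition) (a x : GroupAlg n)
    (hx : x ∈ spechtModule μ) : LinearMap.mulLeft ℚ a x ∈ spechtModule μ := by
  obtain ⟨y, rfl⟩ := hx
  exact ⟨a * y, by simp [mul_assoc]⟩

/-- The action of `w ∈ 𝔖_n` on the Specht module `S^μ` by left multiplication. -/
def spechtAction {n : ℕ} (μ : n.Partition) (w : Equiv.Perm (Fin n)) :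
    spechtModule μ →ₗ[ℚ] spechtModule μ :=
  (LinearMap.mulLeft ℚ (MonoidAlgebra.single w (1 : ℚ) : GroupAlg n)).restrict
    (mul_mem_spechtModule μ _)

/-- The irreducible character `χ^μ` of `𝔖_n`. -/
def irrChar {n : ℕ} (μ : n.Partition) (w : Equiv.Perm (Fin n)) : ℚ :=
  LinearMap.trace ℚ (spechtModule μ) (spechtAction μ w)

/-! ### Symmetric functions, chromatic symmetric functions, and evaluation at a graph -/

open Classical in
/-- The monomial symmetric function `m_μ` in countably many variables: the sum of all monomials
whose multiset of nonzero exponents is `μ`. -/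
def monomialSymm {n : ℕ} (μ : n.Partition) : MvPowerSeries ℕ ℚ :=
  fun d => if d.support.val.map d = μ.parts then 1 else 0

/-- `Y(D) = ∑_{μ ⊢ n} ε^μ(D) m_μ`. -/
def symmGen {n : ℕ} (D : GroupAlg n) : MvPowerSeries ℕ ℚ :=
  ∑ μ : n.Partition, evalAlg (epsilonChar μ) D • monomialSymm μ

/-- `c(G, μ)`: the number of proper colorings of `G` in which exactly `μ_i` vertices have the
`i`-th color, for all `i` (with `μ_i = 0` for `i` beyond the number of parts). The set of colors
is `ℕ`, the `i`-th color being `i - 1`. -/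
def numColorings {V : Type*} {n : ℕ} (G : SimpleGraph V) (μ : n.Partition) : ℕ :=
  Nat.card {κ : G.Coloring ℕ // ∀ i : ℕ, Nat.card {v : V // κ v = i} = (rowList μ).getD i 0}

/-- The chromatic symmetric function `X_G = ∑_{μ ⊢ n} c(G, μ) m_μ` of a graph on `n` vertices. -/
def chromSymm {V : Type*} (n : ℕ) (G : SimpleGraph V) : MvPowerSeries ℕ ℚ :=
  ∑ μ : n.Partition, (numColorings G μ : ℚ) • monomialSymm μ

/-- `θ(G)` is well defined and equal to `a`, for `G` a graph on `n` vertices and `θ` a function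
on `𝔖_n`: there is an element `D ∈ ℚ[𝔖_n]` with `Y(D) = X_G`, and every such `D` satisfies
`θ(D) = a`. -/
def HasEval {V : Type*} {n : ℕ} (θ : Equiv.Perm (Fin n) → ℚ) (G : SimpleGraph V) (a : ℚ) : Prop :=
  (∃ D : GroupAlg n, symmGen D = chromSymm n G) ∧
    ∀ D : GroupAlg n, symmGen D = chromSymm n G → evalAlg θ D = a

/-- The incomparability graph `inc(P)` of a poset. -/
def incGraph (P : Type*) [PartialOrder P] : SimpleGraph P where
  Adj x y := IncompRel (· ≤ ·) x y
  symm := ⟨fun _ _ h => ⟨h.2, h.1⟩⟩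
  loopless := ⟨fun x h => h.1 (le_refl x)⟩

/-! ### `P`-tableaux -/

/-- The Young diagram of a partition. The box `(i, j)` lies in row `i` and column `j`, both counted
from `0`; row `0` is the first (and longest) row. -/
def diagram {n : ℕ} (μ : n.Partition) : YoungDiagram :=
  YoungDiagram.ofRowLens (rowList μ) (rowList_sortedGE μ)

/-- The boxes of the Young diagram of `μ`. -/
abbrev Box {n : ℕ} (μ : n.Partition) : Type := {c : ℕ × ℕ // c ∈ diagram μ}

/-- A `P`-tableau of shape `μ`: a filling of the Young diagram of `μ` with the elements of `P`,
each used exactly once. -/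
abbrev PTableau {n : ℕ} (P : Type*) (μ : n.Partition) : Type _ := Box μ ≃ P

/-- Standard `P`-tableaux: entries of each column satisfy `T_{i,j} <_P T_{i+1,j}`
(column-strictness), and no row has a descent `T_{i,j} >_P T_{i,j+1}` (row-semistrictness). -/
def IsStandard {n : ℕ} {P : Type*} [PartialOrder P] {μ : n.Partition} (T : PTableau P μ) : Prop :=
  (∀ b b' : Box μ, b'.1.1 = b.1.1 + 1 → b'.1.2 = b.1.2 → T b < T b') ∧
    (∀ b b' : Box μ, b'.1.1 = b.1.1 → b'.1.2 = b.1.2 + 1 → ¬ T b > T b')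

/-- Standard `P`-tableaux of shape `μ` in which one entry of the first row is marked and is
incomparable in `P` to an entry in an earlier column. -/
def MarkedTableau {n : ℕ} (P : Type*) [PartialOrder P] (μ : n.Partition) : Type _ :=
  {Tb : PTableau P μ × Box μ // IsStandard Tb.1 ∧ Tb.2.1.1 = 0 ∧
    ∃ b' : Box μ, b'.1.2 < Tb.2.1.2 ∧ IncompRel (· ≤ ·) (Tb.1 b') (Tb.1 Tb.2)}

end ChromTrace

end

/-! Let f_i be the number of standard P-tableaux of hook shape whose leg (the first column without
the corner) has i boxes. Two facts give the theorem: the value of χ^{k1^{n-k}} at inc(P) is f_{n-k},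
and (k-1) f_{n-k} = M + (n-k+1) f_{n-k+1}, where M is the number of marked tableaux.

Character values. By Pieri's rule (`irrChar_hook_add`) two neighbouring hook characters add up to a
character φ_i induced from sgn ⊗ triv on 𝔖_i × 𝔖_{n-i}. The equation Y(D) = X_{inc(P)} prescribes
only the values ε^μ(D), that is, products of elementary symmetric functions, whereas φ_i corresponds
to e_i h_{n-i}. The expansion of h in terms of the e's is carried out on set functions:
`WeightInverse` is the relation ∑ (-1)^i e_i h_{m-i} = 0 for a pair p, q in the roles of e and h.
For a permutation, p is the sign on stable subsets and q their indicator (`perm_weightInverse`); for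
the poset, p is the indicator of chains and q counts descent-free enumerations
(`poset_weightInverse`). Both ε^μ and the coloring numbers are sums of products of p over ordered
set partitions, so `weightSum_transfer` carries their equality over to products ending in a factor
q. Hence φ_i(D) counts the pairs of a descent-free list and an increasing list of length i. These
pairs number f_i + f_{i-1} for i > 0 (`ncard_listPairs_succ`), the same recursion as Pieri's rule,
and induction on the leg gives the values for every admissible D. Such a D exists because the values
of the ε^μ at permutations of given cycle types form a triangular system
(`exists_perm_epsilonChar`).

Marked tableaux. There are k-1 ways to mark an entry x of the first row outside the corner. If x is
comparable to everything in earlier columns, then the absence of descents forces all row entries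
before x to be smaller than x, so x can be removed from the row and inserted into the leg. This is a
bijection onto the fillings of the next hook with a marked leg entry (`ncard_legMarked_eq`), of
which there are (n-k+1) f_{n-k+1}; the other markings are those counted by M. -/

noncomputable section

namespace ChromTrace

/-! ### Sums of multiplicative weights over ordered set partitions -/

section Weights

variable {V W : Type*} [DecidableEq V] [DecidableEq W]

/-- The sum of `p S₁ ⋯ p S_l · q R` over all sequences of pairwise disjoint subsets `S₁, …, S_l` of
`U` of the prescribed cardinalities, where `R` is the rest of `U`. -/
def weightSum (p q : Finset V → ℚ) : List ℕ → Finset V → ℚ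
  | [], U => q U
  | a :: α, U => ∑ S ∈ U.powersetCard a, p S * weightSum p q α (U \ S)

/-- `q` is the inverse of the set function `S ↦ (-1)^|S| p S` for the product of set functions
that sums over decompositions into two disjoint subsets. -/
structure WeightInverse (p q : Finset V → ℚ) : Prop where
  left_empty : p ∅ = 1
  right_empty : q ∅ = 1
  alternating : ∀ T : Finset V, T.Nonempty →
    ∑ S ∈ T.powerset, (-1) ^ S.card * (p S * q (T \ S)) = 0

/-- For two adjacent blocks both orders sum over the same pairs of disjoint subsets. This reconciles
the sorted parts of a partition with blocks that are appended one at a time. -/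
theorem weightSum_perm (p q : Finset V → ℚ) {α β : List ℕ} (h : α.Perm β) (U : Finset V) :
    weightSum p q α U = weightSum p q β U := by
  induction h generalizing U with
  | nil => rfl
  | cons a _ ih => simp only [weightSum, ih]
  | swap a b l =>
    simp only [weightSum, Finset.mul_sum]
    rw [Finset.sum_comm' (t' := U.powersetCard a) (s' := fun S => (U \ S).powersetCard b)]
    · refine Finset.sum_congr rfl fun S _ => Finset.sum_congr rfl fun S' _ => ?_
      rw [sdiff_right_comm]; ring
    · intro S S'
      simp only [Finset.mem_powersetCard, Finset.subset_sdiff]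
      constructor
      · rintro ⟨⟨h1, h2⟩, ⟨h3, h4⟩, h5⟩
        exact ⟨⟨⟨h1, h4.symm⟩, h2⟩, h3, h5⟩
      · rintro ⟨⟨⟨h1, h4⟩, h2⟩, h3, h5⟩
        exact ⟨⟨h1, h2⟩, ⟨h3, h4.symm⟩, h5⟩
  | trans _ _ ih1 ih2 => rw [ih1, ih2]

/-- Solving the alternating relation for its term S = ∅; the analogue of h_m = ∑ (-1)^i e_{i+1}
h_{m-i-1}. -/
theorem WeightInverse.eq_sum {p q : Finset V → ℚ} (h : WeightInverse p q) {T : Finset V}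
    (hT : T.Nonempty) :
    q T = ∑ i ∈ Finset.range T.card, (-1) ^ i * weightSum p q [i + 1] T := by
  have h0 := h.alternating T hT
  rw [Finset.sum_powerset, Finset.sum_range_succ'] at h0
  simp only [Finset.powersetCard_zero, Finset.sum_singleton, Finset.card_empty, pow_zero,
    Finset.sdiff_empty, h.left_empty, one_mul] at h0
  rw [← sub_eq_zero, ← h0, sub_eq_add_neg, add_comm, ← Finset.sum_neg_distrib]
  congr 1
  refine Finset.sum_congr rfl fun i _ => ?_
  simp only [weightSum]
  rw [Finset.mul_sum, ← Finset.sum_neg_distrib]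
  refine Finset.sum_congr rfl fun S hS => ?_
  rw [(Finset.mem_powersetCard.1 hS).2]; ring

/-- The remainder has the same size k in every term, so `eq_sum` expands it uniformly; each new
block is appended and leaves a smaller remainder. -/
theorem WeightInverse.weightSum_eq_sum {p q : Finset V → ℚ} (h : WeightInverse p q) {k : ℕ}
    (hk : 0 < k) (α : List ℕ) (U : Finset V) (hU : U.card = α.sum + k) :
    weightSum p q α U =
      ∑ i ∈ Finset.range k, (-1) ^ i * weightSum p q (α ++ [i + 1]) U := by
  induction α generalizing U with
  | nil =>
    have hU' : U.card = k := by simpa using hU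
    rw [← hU']
    exact h.eq_sum (Finset.card_pos.1 (by omega))
  | cons a α ih =>
    simp only [weightSum, List.cons_append, Finset.mul_sum]
    rw [Finset.sum_comm]
    refine Finset.sum_congr rfl fun S hS => ?_
    obtain ⟨hS1, hS2⟩ := Finset.mem_powersetCard.1 hS
    rw [ih (U \ S), Finset.mul_sum]
    · exact Finset.sum_congr rfl fun i _ => by ring
    · rw [Finset.card_sdiff_of_subset hS1, hS2, hU, List.sum_cons]; omega

theorem weightSum_zero_cons {p q : Finset V → ℚ} (h : WeightInverse p q) (α : List ℕ)
    (U : Finset V) : weightSum p q (0 :: α) U = weightSum p q α U := by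
  simp [weightSum, h.left_empty]

/-- The partition whose parts are the entries of a list of positive numbers. -/
def partitionOfList {n : ℕ} (α : List ℕ) (hpos : ∀ a ∈ α, 0 < a) (hsum : α.sum = n) :
    n.Partition where
  parts := (α : Multiset ℕ)
  parts_pos := fun {i} hi => hpos i (Multiset.mem_coe.1 hi)
  parts_sum := by simpa using hsum

theorem rowList_perm {n : ℕ} (μ : n.Partition) {α : List ℕ} (h : μ.parts = (α : Multiset ℕ)) :
    (rowList μ).Perm α := by
  rw [← Multiset.coe_eq_coe, ← h, rowList, Multiset.sort_eq]

/-- A linear relation between weight sums without remainder extends to all weight sums. -/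
theorem weightSum_transfer {ι : Type*} [Fintype ι] [Fintype V] [Fintype W] {n : ℕ}
    (hV : Fintype.card V = n) (hW : Fintype.card W = n) (c : ι → ℚ) {p q : ι → Finset V → ℚ}
    {p' q' : Finset W → ℚ} (h : ∀ i, WeightInverse (p i) (q i)) (h' : WeightInverse p' q')
    (H : ∀ μ : n.Partition, ∑ i, c i * weightSum (p i) (q i) (rowList μ) Finset.univ =
      weightSum p' q' (rowList μ) Finset.univ)
    (α : List ℕ) (hpos : ∀ a ∈ α, 0 < a) (hsum : α.sum ≤ n) :
    ∑ i, c i * weightSum (p i) (q i) α Finset.univ = weightSum p' q' α Finset.univ := by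
  obtain ⟨k, hk⟩ := Nat.exists_eq_add_of_le hsum
  induction k using Nat.strong_induction_on generalizing α with
  | _ k ih =>
    rcases Nat.eq_zero_or_pos k with rfl | hk0
    -- With an empty remainder, `α` is a rearrangement of the parts of a partition of n, and `H`
    -- applies.
    · have hperm := rowList_perm (partitionOfList α hpos (by omega : α.sum = n)) rfl
      rw [← weightSum_perm _ _ hperm, ← H]
      simp only [weightSum_perm _ _ hperm]
    -- A nonempty remainder is traded on both sides for a last block j + 1 and a remainder of size k
    -- - (j + 1), with the same signs.
    · rw [h'.weightSum_eq_sum hk0 α Finset.univ (by rw [Finset.card_univ, hW, hk])]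
      simp only [fun i => (h i).weightSum_eq_sum hk0 α Finset.univ
        (by rw [Finset.card_univ, hV, hk]), Finset.mul_sum]
      rw [Finset.sum_comm]
      refine Finset.sum_congr rfl fun j hj => ?_
      have hj' := Finset.mem_range.1 hj
      rw [← ih (k - (j + 1)) (by omega) (α ++ [j + 1]) _ _ _, Finset.mul_sum]
      · exact Finset.sum_congr rfl fun i _ => by ring
      · intro a ha
        rcases List.mem_append.1 ha with ha | ha
        · exact hpos a ha
        · rw [List.mem_singleton.1 ha]; omega
      · simp; omega
      · simp; omega

end Weights

/-! ### The weights attached to a poset -/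

section PosetWeights

variable {P : Type*} [PartialOrder P] [DecidableEq P]

/-- The enumerations of `S` in strictly increasing order. -/
def increasingLists (S : Finset P) : Set (List P) :=
  {c | c.Nodup ∧ c.toFinset = S ∧ c.IsChain (· < ·)}

/-- The enumerations of `T` without descents. -/
def descentFreeLists (T : Finset P) : Set (List P) :=
  {l | l.Nodup ∧ l.toFinset = T ∧ l.IsChain fun a b => ¬ b < a}

/-- Pairs of a descent-free list and an increasing list of length `i` which together enumerate
`T`. -/
def listPairs (T : Finset P) (i : ℕ) : Set (List P × List P) :=
  {x | (x.1 ++ x.2).Nodup ∧ (x.1 ++ x.2).toFinset = T ∧ x.2.length = i ∧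
    (x.1.IsChain fun a b => ¬ b < a) ∧ x.2.IsChain (· < ·)}

/-- Standard hook fillings with entries `T` and leg of length `i`: pairs of the first row and the
rest of the first column. -/
def hookPairs (T : Finset P) (i : ℕ) : Set (List P × List P) :=
  {x | x ∈ listPairs T i ∧ ∃ a l, x.1 = a :: l ∧ (a :: x.2).IsChain (· < ·)}

omit [PartialOrder P] [DecidableEq P] in
theorem finite_nodup [Finite P] : {l : List P | l.Nodup}.Finite := by
  have := Fintype.ofFinite P
  exact Set.finite_coe_iff.1 (inferInstanceAs (Finite {l : List P // l.Nodup}))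

theorem finite_increasingLists [Finite P] (S : Finset P) : (increasingLists S).Finite :=
  finite_nodup.subset fun _ h => h.1

theorem finite_descentFreeLists [Finite P] (S : Finset P) : (descentFreeLists S).Finite :=
  finite_nodup.subset fun _ h => h.1

theorem finite_listPairs [Finite P] (T : Finset P) (i : ℕ) : (listPairs T i).Finite :=
  (finite_nodup.prod finite_nodup).subset fun _ h =>
    ⟨(List.nodup_append.1 h.1).1, (List.nodup_append.1 h.1).2.1⟩

theorem finite_hookPairs [Finite P] (T : Finset P) (i : ℕ) : (hookPairs T i).Finite :=
  (finite_listPairs T i).subset fun _ h => h.1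

/-- With an empty leg the hook condition only asks for a corner, which exists as soon as T is
nonempty. -/
theorem ncard_listPairs_zero {T : Finset P} (hT : T.Nonempty) :
    (listPairs T 0).ncard = (hookPairs T 0).ncard := by
  congr 1
  ext ⟨l, c⟩
  refine ⟨fun h => ⟨h, ?_⟩, fun h => h.1⟩
  obtain ⟨-, h2, h3, -, -⟩ := h
  have hc : c = [] := List.length_eq_zero_iff.1 h3
  subst hc
  cases l with
  | nil => simp at h2; exact absurd h2.symm hT.ne_empty
  | cons a l => exact ⟨a, l, rfl, by simp⟩

/-- A poset form of Pieri's rule. If a pair is not a hook filling, the head of its increasing list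
is not above the head of its row (or the row is empty). Moved to the front of the row, it creates no
descent and becomes the corner of a hook with a shorter leg. Moving the corner of such a hook back
reverses this. -/
theorem ncard_listPairs_succ [Finite P] (T : Finset P) (i : ℕ) :
    (listPairs T (i + 1)).ncard = (hookPairs T (i + 1)).ncard + (hookPairs T i).ncard := by
  have hsub : hookPairs T (i + 1) ⊆ listPairs T (i + 1) := fun _ h => h.1
  rw [← Set.ncard_sdiff_add_ncard_of_subset hsub (finite_listPairs T _), add_comm]
  congr 1
  refine Set.ncard_congr (fun y _ => (y.2.take 1 ++ y.1, y.2.tail)) ?_ ?_ ?_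
  · rintro ⟨l, c⟩ ⟨⟨h1, h2, h3, h4, h5⟩, hn⟩
    obtain ⟨x, c, rfl⟩ := List.exists_cons_of_length_eq_add_one h3
    have hperm : (l ++ x :: c).Perm (x :: l ++ c) := List.perm_middle
    refine ⟨⟨by simpa using hperm.nodup_iff.1 h1, ?_, by simpa using h3, ?_, h5.tail⟩,
      x, l, by simp, h5⟩
    · rw [← h2]
      exact (List.toFinset_eq_of_perm _ _ hperm).symm
    · cases l with
      | nil => simp
      | cons a l =>
        refine List.isChain_cons_cons.2 ⟨fun hax => hn ⟨⟨h1, h2, h3, h4, h5⟩, a, l, rfl, ?_⟩, h4⟩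
        exact List.isChain_cons_cons.2 ⟨hax, h5⟩
  · rintro ⟨l, c⟩ ⟨l', c'⟩ h h' he
    obtain ⟨x, c, rfl⟩ := List.exists_cons_of_length_eq_add_one h.1.2.2.1
    obtain ⟨x', c', rfl⟩ := List.exists_cons_of_length_eq_add_one h'.1.2.2.1
    simp only [List.take_succ_cons, List.take_zero, List.cons_append, List.nil_append,
      List.tail_cons, Prod.mk.injEq, List.cons.injEq] at he
    obtain ⟨⟨rfl, rfl⟩, rfl⟩ := he
    rfl
  · rintro ⟨l, c⟩ ⟨⟨h1, h2, h3, h4, h5⟩, x, l, rfl, h6⟩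
    have hperm : (l ++ x :: c).Perm (x :: l ++ c) := List.perm_middle
    refine ⟨(l, x :: c), ⟨⟨hperm.nodup_iff.2 h1, ?_, by simpa using h3, h4.tail, h6⟩, ?_⟩, by simp⟩
    · rw [← h2]
      exact (List.toFinset_eq_of_perm _ _ hperm)
    · rintro ⟨-, a, l, rfl, h7⟩
      exact (List.isChain_cons_cons.1 h4).1 (List.isChain_cons_cons.1 h7).1

/-- The corner belongs to the row, so the leg cannot use up all of T. This ends the telescoping in
`poset_weightInverse`. -/
theorem hookPairs_eq_empty {T : Finset P} {i : ℕ} (h : T.card ≤ i) : hookPairs T i = ∅ := by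
  refine Set.eq_empty_of_forall_notMem ?_
  rintro ⟨l, c⟩ ⟨⟨h1, h2, h3, -, -⟩, x, l, rfl, -⟩
  have := List.toFinset_card_of_nodup h1
  rw [h2] at this
  simp at this h3
  omega

/-- The number of increasing enumerations of a set. -/
def increasingWeight (S : Finset P) : ℚ := (increasingLists S).ncard

/-- The number of descent-free enumerations of a set. -/
def descentFreeWeight (S : Finset P) : ℚ := (descentFreeLists S).ncard

theorem mem_listPairs_iff {T : Finset P} {i : ℕ} {l c : List P} :
    (l, c) ∈ listPairs T i ↔ c.toFinset ∈ T.powersetCard i ∧ c ∈ increasingLists c.toFinset ∧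
      l ∈ descentFreeLists (T \ c.toFinset) := by
  simp only [listPairs, increasingLists, descentFreeLists, Set.mem_ofPred_eq, List.nodup_append',
    Finset.mem_powersetCard, List.toFinset_append]
  constructor
  · rintro ⟨⟨h1, h2, h3⟩, rfl, rfl, h4, h5⟩
    refine ⟨⟨Finset.subset_union_right, List.toFinset_card_of_nodup h2⟩, ⟨h2, trivial, h5⟩, h1, ?_, h4⟩
    rw [Finset.union_sdiff_right, eq_comm, Finset.sdiff_eq_self_iff_disjoint,
      List.disjoint_toFinset_iff_disjoint]
    exact h3
  · rintro ⟨⟨h1, rfl⟩, ⟨h2, -, h3⟩, h4, h5, h6⟩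
    refine ⟨⟨h4, h2, ?_⟩, ?_, (List.toFinset_card_of_nodup h2).symm, h6, h3⟩
    · rw [← List.disjoint_toFinset_iff_disjoint, h5]
      exact Finset.sdiff_disjoint
    · rw [h5, Finset.sdiff_union_of_subset h1]

/-- Once the set occupied by the increasing list is fixed, the two lists are chosen independently.
The count is thus a weight sum with one block. -/
theorem ncard_listPairs [Finite P] (T : Finset P) (i : ℕ) :
    ((listPairs T i).ncard : ℚ) =
      ∑ S ∈ T.powersetCard i, increasingWeight S * descentFreeWeight (T \ S) := by
  let e : listPairs T i ≃
      Σ S : T.powersetCard i, increasingLists (S : Finset P) × descentFreeLists (T \ S) :=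
    { toFun := fun x => ⟨⟨x.1.2.toFinset, (mem_listPairs_iff.1 x.2).1⟩,
        ⟨x.1.2, (mem_listPairs_iff.1 x.2).2.1⟩, ⟨x.1.1, (mem_listPairs_iff.1 x.2).2.2⟩⟩
      invFun := fun y => ⟨(y.2.2.1, y.2.1.1), by
        obtain ⟨⟨S, hS⟩, ⟨c, hc⟩, ⟨l, hl⟩⟩ := y
        obtain rfl : c.toFinset = S := hc.2.1
        exact mem_listPairs_iff.2 ⟨hS, hc, hl⟩⟩
      left_inv := fun x => rfl
      right_inv := by
        rintro ⟨⟨S, hS⟩, ⟨c, hc⟩, ⟨l, hl⟩⟩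
        obtain rfl : c.toFinset = S := hc.2.1
        rfl }
  have h1 : ∀ S : Finset P, Finite (increasingLists S) := fun S => finite_increasingLists S
  have h2 : ∀ S : Finset P, Finite (descentFreeLists S) := fun S => finite_descentFreeLists S
  rw [← Nat.card_coe_set_eq, Nat.card_congr e, Nat.card_sigma]
  simp only [Nat.card_prod, Nat.card_coe_set_eq]
  push_cast
  exact Finset.sum_coe_sort (T.powersetCard i)
    fun S => increasingWeight S * descentFreeWeight (T \ S)

omit [PartialOrder P] in
theorem lists_empty (R : P → P → Prop) :
    {c : List P | c.Nodup ∧ c.toFinset = ∅ ∧ c.IsChain R} = {[]} := by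
  ext c
  simp only [Set.mem_ofPred_eq, List.toFinset_eq_empty_iff, Set.mem_singleton_iff]
  constructor
  · exact fun h => h.2.1
  · rintro rfl
    simp

/-- Grouped by |S|, the terms count list pairs, and each such count is the sum of two consecutive
hook counts. The alternating sum telescopes to the hook count with a leg of length |T|, which is
zero. -/
theorem poset_weightInverse [Finite P] :
    WeightInverse (increasingWeight (P := P)) descentFreeWeight where
  left_empty := by
    rw [increasingWeight, increasingLists, lists_empty, Set.ncard_singleton, Nat.cast_one]
  right_empty := by
    rw [descentFreeWeight, descentFreeLists, lists_empty, Set.ncard_singleton, Nat.cast_one]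
  alternating := by
    intro T hT
    have key : ∀ m, ∑ i ∈ Finset.range (m + 1), (-1 : ℚ) ^ i * (listPairs T i).ncard =
        (-1) ^ m * (hookPairs T m).ncard := by
      intro m
      induction m with
      | zero => simp [ncard_listPairs_zero hT]
      | succ m ih =>
        rw [Finset.sum_range_succ, ih, ncard_listPairs_succ]
        push_cast
        ring
    have h := key T.card
    rw [hookPairs_eq_empty le_rfl, Set.ncard_empty, Nat.cast_zero, mul_zero] at h
    rw [Finset.sum_powerset, ← h]
    refine Finset.sum_congr rfl fun i _ => ?_
    rw [ncard_listPairs, Finset.mul_sum]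
    refine Finset.sum_congr rfl fun S hS => ?_
    rw [(Finset.mem_powersetCard.1 hS).2]

/-! ### Chains and their increasing enumerations -/

theorem exists_increasingList (S : Finset P) (hS : IsChain (· ≤ ·) (S : Set P)) :
    ∃ c, c ∈ increasingLists S := by
  induction S using Finset.strongInduction with
  | H S ih =>
    rcases S.eq_empty_or_nonempty with rfl | hne
    · exact ⟨[], by simp [increasingLists]⟩
    · obtain ⟨m, hm⟩ := S.exists_minimal hne
      obtain ⟨c, h1, h2, h3⟩ := ih (S.erase m) (Finset.erase_ssubset hm.1)
        (hS.mono (by simp))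
      have hlt : ∀ x ∈ c, m < x := by
        intro x hx
        rw [← List.mem_toFinset, h2, Finset.mem_erase] at hx
        rcases hS hm.1 hx.2 hx.1.symm with h | h
        · exact lt_of_le_of_ne h hx.1.symm
        · exact lt_of_le_of_ne (hm.2 hx.2 h) hx.1.symm
      refine ⟨m :: c, List.nodup_cons.2 ⟨fun h => lt_irrefl _ (hlt m h), h1⟩, ?_, ?_⟩
      · rw [List.toFinset_cons, h2, Finset.insert_erase hm.1]
      · rw [List.isChain_iff_pairwise] at h3 ⊢
        exact List.pairwise_cons.2 ⟨hlt, h3⟩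

theorem increasingLists_subsingleton (S : Finset P) : (increasingLists S).Subsingleton := by
  rintro c ⟨h1, h2, h3⟩ c' ⟨h1', h2', h3'⟩
  rw [List.isChain_iff_pairwise] at h3 h3'
  exact (List.perm_of_nodup_nodup_toFinset_eq h1 h1' (h2.trans h2'.symm)).eq_of_pairwise
    (fun a b _ _ hab hba => absurd hba hab.not_gt) h3 h3'

theorem isChain_of_increasingList {S : Finset P} {c : List P} (h : c ∈ increasingLists S) :
    IsChain (· ≤ ·) (S : Set P) := by
  obtain ⟨-, rfl, h3⟩ := h
  rw [List.isChain_iff_pairwise] at h3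
  intro a ha b hb hab
  have hs : Std.Symm fun a b : P => a ≤ b ∨ b ≤ a := ⟨fun _ _ h => Or.symm h⟩
  have h4 : c.Pairwise fun a b : P => a ≤ b ∨ b ≤ a := h3.imp fun h => Or.inl h.le
  exact List.Pairwise.forall_of_forall (R := fun a b : P => a ≤ b ∨ b ≤ a)
    (fun _ _ => Or.inl le_rfl) h4 (by simpa using ha) (by simpa using hb)

open Classical in
-- An increasing enumeration is unique if it exists, and it exists for chains only. This links the
-- weight to color classes of the incomparability graph.
theorem increasingWeight_eq (S : Finset P) :
    increasingWeight S = if IsChain (· ≤ ·) (S : Set P) then 1 else 0 := by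
  rw [increasingWeight]
  split_ifs with h
  · obtain ⟨c, hc⟩ := exists_increasingList S h
    rw [(increasingLists_subsingleton S).eq_singleton_of_mem hc, Set.ncard_singleton,
      Nat.cast_one]
  · rw [Set.eq_empty_of_forall_notMem fun c hc => h (isChain_of_increasingList hc),
      Set.ncard_empty, Nat.cast_zero]

end PosetWeights

/-! ### The weights attached to a permutation -/

section PermWeights

set_option linter.unusedSectionVars false

variable {V : Type*} [Fintype V] [DecidableEq V]

/-- `w` maps `S` onto itself. -/
def Stable (w : Equiv.Perm V) (S : Finset V) : Prop := ∀ x, w x ∈ S ↔ x ∈ S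

open Classical in
/-- The permutation that agrees with `w` on `S`, and fixes the elements outside `S`. -/
def restrictPerm (w : Equiv.Perm V) (S : Finset V) : Equiv.Perm V :=
  if h : Stable w S then Equiv.Perm.ofSubtype (w.subtypePerm h) else 1

theorem restrictPerm_apply {w : Equiv.Perm V} {S : Finset V} (h : Stable w S) (x : V) :
    restrictPerm w S x = if x ∈ S then w x else x := by
  rw [restrictPerm, dif_pos h]
  split_ifs with hx
  · rw [Equiv.Perm.ofSubtype_apply_of_mem _ hx]; rfl
  · rw [Equiv.Perm.ofSubtype_apply_of_not_mem _ hx]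

theorem Stable.sdiff {w : Equiv.Perm V} {S T : Finset V} (hS : Stable w S) (hT : Stable w T) :
    Stable w (S \ T) := fun x => by rw [Finset.mem_sdiff, Finset.mem_sdiff, hS, hT]

theorem Stable.union {w : Equiv.Perm V} {S T : Finset V} (hS : Stable w S) (hT : Stable w T) :
    Stable w (S ∪ T) := fun x => by rw [Finset.mem_union, Finset.mem_union, hS, hT]

theorem Stable.symmDiff {w : Equiv.Perm V} {S T : Finset V} (hS : Stable w S) (hT : Stable w T) :
    Stable w (symmDiff S T) := fun x => by rw [Finset.mem_symmDiff, Finset.mem_symmDiff, hS, hT]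

theorem stable_univ (w : Equiv.Perm V) : Stable w Finset.univ := fun x => by simp

theorem stable_empty (w : Equiv.Perm V) : Stable w ∅ := fun x => by simp

theorem restrictPerm_union {w : Equiv.Perm V} {S T : Finset V} (hS : Stable w S)
    (hT : Stable w T) (hd : Disjoint S T) :
    restrictPerm w (S ∪ T) = restrictPerm w S * restrictPerm w T := by
  ext x
  rw [Equiv.Perm.mul_apply, restrictPerm_apply (hS.union hT), restrictPerm_apply hS,
    restrictPerm_apply hT]
  by_cases hx : x ∈ T
  · have : w x ∉ S := fun h => Finset.disjoint_left.1 hd ((hS x).1 h) hx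
    simp [hx, this]
  · simp [hx]

theorem restrictPerm_univ (w : Equiv.Perm V) : restrictPerm w Finset.univ = w := by
  ext x; simp [restrictPerm_apply (stable_univ w)]

theorem restrictPerm_empty (w : Equiv.Perm V) : restrictPerm w ∅ = 1 := by
  ext x; simp [restrictPerm_apply (stable_empty w)]

/-- The sign of a permutation as a rational number. -/
def signQ (w : Equiv.Perm V) : ℚ := ((Equiv.Perm.sign w : ℤ) : ℚ)

theorem signQ_mul (v w : Equiv.Perm V) : signQ (v * w) = signQ v * signQ w := by
  simp [signQ]

theorem signQ_one : signQ (1 : Equiv.Perm V) = 1 := by simp [signQ]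

theorem signQ_mul_self (w : Equiv.Perm V) : signQ w * signQ w = 1 := by
  rw [signQ, ← Int.cast_mul, ← Units.val_mul, Int.units_mul_self]; simp

theorem signQ_inv (w : Equiv.Perm V) : signQ w⁻¹ = signQ w := by simp [signQ]

open Classical in
/-- The sign of the restriction of `w` to `S`, or zero if `S` is not stable. -/
def signWeight (w : Equiv.Perm V) (S : Finset V) : ℚ :=
  if Stable w S then signQ (restrictPerm w S) else 0

open Classical in
/-- The indicator function of the stable subsets. -/
def stableWeight (w : Equiv.Perm V) (S : Finset V) : ℚ := if Stable w S then 1 else 0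

open Classical in
/-- The orbit of an element under a permutation. -/
def orbitFinset (w : Equiv.Perm V) (v : V) : Finset V := Finset.univ.filter (w.SameCycle v)

theorem stable_orbitFinset (w : Equiv.Perm V) (v : V) : Stable w (orbitFinset w v) := by
  intro x
  simp [orbitFinset, Equiv.Perm.sameCycle_apply_right]

theorem Stable.sameCycle_mem {w : Equiv.Perm V} {S : Finset V} (hS : Stable w S) {x y : V}
    (h : w.SameCycle x y) : y ∈ S ↔ x ∈ S := by
  obtain ⟨i, rfl⟩ := h
  have hS' : ∀ x, w⁻¹ x ∈ S ↔ x ∈ S := fun x => by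
    rw [← hS (w⁻¹ x), show w (w⁻¹ x) = x from Equiv.apply_symm_apply w x]
  induction i using Int.induction_on with
  | zero => simp
  | succ i ih => rw [add_comm, zpow_add, Equiv.Perm.mul_apply, zpow_one, hS]; exact ih
  | pred i ih =>
    rw [sub_eq_add_neg, add_comm, zpow_add, Equiv.Perm.mul_apply, zpow_neg_one, hS']
    exact ih

open Classical in
-- A cycle of length m has sign (-1)^(m-1). A fixed point is treated apart, since its orbit is not
-- the support of its trivial cycle.
theorem signQ_restrictPerm_orbitFinset (w : Equiv.Perm V) (v : V) :
    (-1) ^ (orbitFinset w v).card * signQ (restrictPerm w (orbitFinset w v)) = -1 := by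
  have hr : restrictPerm w (orbitFinset w v) = w.cycleOf v := by
    ext x
    rw [restrictPerm_apply (stable_orbitFinset w v), Equiv.Perm.cycleOf_apply]
    simp [orbitFinset]
  rw [hr]
  by_cases hv : w v = v
  · have hC : orbitFinset w v = {v} := by
      ext x
      simp only [orbitFinset, Finset.mem_filter, Finset.mem_univ, true_and, Finset.mem_singleton]
      constructor
      · rintro ⟨i, rfl⟩
        exact Function.IsFixedPt.perm_zpow hv i
      · rintro rfl
        exact Equiv.Perm.SameCycle.refl _ _
    rw [hC, (Equiv.Perm.cycleOf_eq_one_iff w).2 hv, signQ_one]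
    simp
  · have hC : (w.cycleOf v).support = orbitFinset w v := by
      ext x
      rw [Equiv.Perm.mem_support_cycleOf_iff' hv]; simp [orbitFinset]
    rw [signQ, (w.isCycle_cycleOf hv).sign, hC]
    push_cast
    rw [mul_neg, ← mul_pow]
    simp

theorem signQ_restrictPerm_union_orbitFinset {w : Equiv.Perm V} {S : Finset V} {v : V}
    (hS : Stable w S) (hd : Disjoint S (orbitFinset w v)) :
    (-1) ^ (S ∪ orbitFinset w v).card * signQ (restrictPerm w (S ∪ orbitFinset w v)) =
      - ((-1) ^ S.card * signQ (restrictPerm w S)) := by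
  rw [restrictPerm_union hS (stable_orbitFinset w v) hd, Finset.card_union_of_disjoint hd,
    signQ_mul, pow_add]
  linear_combination ((-1) ^ S.card * signQ (restrictPerm w S)) *
    signQ_restrictPerm_orbitFinset w v

theorem mem_orbitFinset_self (w : Equiv.Perm V) (v : V) : v ∈ orbitFinset w v := by
  simp [orbitFinset, Equiv.Perm.SameCycle.refl]

/-- A stable set contains the orbit of v or is disjoint from it, so the symmetric difference removes
or adds one whole orbit. Both cases reduce to adding an orbit. -/
theorem signQ_restrictPerm_symmDiff {w : Equiv.Perm V} {S : Finset V} (v : V)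
    (hS : Stable w S) :
    (-1) ^ (symmDiff S (orbitFinset w v)).card *
        signQ (restrictPerm w (symmDiff S (orbitFinset w v))) =
      - ((-1) ^ S.card * signQ (restrictPerm w S)) := by
  by_cases hv : v ∈ S
  · have hsub : orbitFinset w v ⊆ S := fun x hx => by
      rw [orbitFinset, Finset.mem_filter] at hx
      exact (hS.sameCycle_mem hx.2).2 hv
    rw [symmDiff_of_ge hsub]
    have h := signQ_restrictPerm_union_orbitFinset (hS.sdiff (stable_orbitFinset w v))
      Finset.sdiff_disjoint
    rw [Finset.sdiff_union_of_subset hsub] at h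
    rw [h, neg_neg]
  · have hd : Disjoint S (orbitFinset w v) := by
      rw [Finset.disjoint_right]
      intro x hx hxS
      rw [orbitFinset, Finset.mem_filter] at hx
      exact hv ((hS.sameCycle_mem hx.2).1 hxS)
    rw [hd.symmDiff_eq_sup]
    exact signQ_restrictPerm_union_orbitFinset hS hd

/-- For stable T, toggling the orbit of a fixed element of T is a sign-reversing involution without
fixed points. For other T every term vanishes, as S and T \ S cannot both be stable. -/
theorem perm_weightInverse (w : Equiv.Perm V) : WeightInverse (signWeight w) (stableWeight w) where
  left_empty := by rw [signWeight, if_pos (stable_empty w), restrictPerm_empty, signQ_one]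
  right_empty := by rw [stableWeight, if_pos (stable_empty w)]
  alternating := by
    rintro T ⟨v, hv⟩
    by_cases hT : Stable w T
    · have hC := stable_orbitFinset w v
      have hCT : orbitFinset w v ⊆ T := fun x hx => by
        rw [orbitFinset, Finset.mem_filter] at hx
        exact (hT.sameCycle_mem hx.2).2 hv
      refine Finset.sum_involution (fun S _ => symmDiff S (orbitFinset w v)) ?_ ?_ ?_ ?_
      · intro S hS
        by_cases hS' : Stable w S
        · have h := signQ_restrictPerm_symmDiff v hS'
          have hSC := hS'.symmDiff hC
          rw [signWeight, signWeight, stableWeight, stableWeight, if_pos hS', if_pos hSC,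
            if_pos (hT.sdiff hS'), if_pos (hT.sdiff hSC), mul_one, mul_one, h]
          ring
        · have hSC : ¬ Stable w (symmDiff S (orbitFinset w v)) := fun h => hS' (by
            have := h.symmDiff hC
            rwa [symmDiff_symmDiff_cancel_right] at this)
          rw [signWeight, signWeight, if_neg hS', if_neg hSC]
          ring
      · intro S _ _ h
        rw [symmDiff_eq_left] at h
        have hv' := mem_orbitFinset_self w v
        rw [h] at hv'
        exact Finset.notMem_empty v hv'
      · intro S hS
        rw [Finset.mem_powerset] at hS ⊢
        intro x hx
        rcases Finset.mem_symmDiff.1 hx with h | h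
        · exact hS h.1
        · exact hCT h.1
      · intro S _
        exact symmDiff_symmDiff_cancel_right _ _
    · refine Finset.sum_eq_zero fun S hS => ?_
      by_cases h1 : Stable w S
      · by_cases h2 : Stable w (T \ S)
        · have := h1.union h2
          rw [Finset.union_sdiff_of_subset (Finset.mem_powerset.1 hS)] at this
          exact absurd this hT
        · rw [stableWeight, if_neg h2]; ring
      · rw [signWeight, if_neg h1]; ring

end PermWeights

/-! ### Weight sums as numbers of functions -/

section Counting

set_option linter.unusedSectionVars false

variable {V : Type*} [Fintype V] [DecidableEq V]

/-- The fibre of a function over `i`. -/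
def fiber (f : V → ℕ) (i : ℕ) : Finset V := Finset.univ.filter fun v => f v = i

theorem mem_fiber {f : V → ℕ} {i : ℕ} {v : V} : v ∈ fiber f i ↔ f v = i := by simp [fiber]

/-- The functions that vanish exactly outside `U`, and whose fibres over the positive integers have
the prescribed cardinalities and satisfy a given property. -/
def fiberFunctions (R : Finset V → Prop) (α : List ℕ) (U : Finset V) : Set (V → ℕ) :=
  {f | (∀ v, f v = 0 ↔ v ∉ U) ∧ ∀ i, R (fiber f (i + 1)) ∧ (fiber f (i + 1)).card = α.getD i 0}

theorem finite_fiberFunctions (R : Finset V → Prop) (α : List ℕ) (U : Finset V) :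
    (fiberFunctions R α U).Finite := by
  refine (Set.Finite.pi' (t := fun _ : V => Set.Iic α.length)
    fun _ => Set.finite_Iic _).subset ?_
  intro f hf v
  rw [Set.mem_Iic]
  by_contra! h
  obtain ⟨i, hi⟩ := Nat.exists_eq_succ_of_ne_zero (n := f v) (by omega)
  have h2 := (hf.2 i).2
  -- Entries of `α` past its end read as 0, so the corresponding fibres are empty and the values of
  -- f are bounded.
  rw [List.getD_eq_default _ _ (by omega), Finset.card_eq_zero] at h2
  exact Finset.notMem_empty v (h2 ▸ mem_fiber.2 hi)

theorem fiberFunctions_nil {R : Finset V → Prop} (hR : R ∅) : fiberFunctions R [] ∅ = {0} := by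
  ext f
  simp only [fiberFunctions, Set.mem_ofPred_eq, Set.mem_singleton_iff, Finset.notMem_empty,
    not_false_iff, iff_true]
  constructor
  · exact fun h => funext h.1
  · rintro rfl
    have h : ∀ i, fiber (0 : V → ℕ) (i + 1) = ∅ := fun i => by
      ext v; simp [mem_fiber]
    simp [h, hR]

/-- Lowering all values by one, with truncation at 0, merges the fibre over 1 into the zero set,
which marks the complement of the remaining ground set. -/
theorem cons_mem_fiberFunctions {R : Finset V → Prop} {a : ℕ} {α : List ℕ} {U : Finset V}
    {f : V → ℕ} : f ∈ fiberFunctions R (a :: α) U ↔ (∀ v, f v = 0 ↔ v ∉ U) ∧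
      fiber f 1 ∈ U.powersetCard a ∧ R (fiber f 1) ∧
      (fun v => f v - 1) ∈ fiberFunctions R α (U \ fiber f 1) := by
  have h1 : ∀ i, fiber (fun v => f v - 1) (i + 1) = fiber f (i + 2) := fun i => by
    ext v; simp only [mem_fiber]; omega
  simp only [fiberFunctions, Set.mem_ofPred_eq, h1, Finset.mem_powersetCard]
  constructor
  · rintro ⟨h, h2⟩
    refine ⟨h, ⟨?_, by simpa using (h2 0).2⟩, (h2 0).1, ?_, fun i => ⟨(h2 (i + 1)).1, ?_⟩⟩
    · intro v hv
      by_contra hU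
      rw [mem_fiber, (h v).2 hU] at hv
      omega
    · intro v
      have := h v
      rw [Finset.mem_sdiff, mem_fiber]
      by_cases hv : v ∈ U
      · simp only [hv, not_true, iff_false] at this
        simp only [hv, true_and, not_not]
        omega
      · simp [hv, this.2 hv]
    · simpa using (h2 (i + 1)).2
  · rintro ⟨h, ⟨h2, h3⟩, h4, h5, h6⟩
    refine ⟨h, fun i => ?_⟩
    cases i with
    | zero => exact ⟨h4, by simpa using h3⟩
    | succ i => exact ⟨(h6 i).1, by simpa using (h6 i).2⟩

open Classical in
theorem ncard_fiberFunctions_cons (R : Finset V → Prop) (a : ℕ) (α : List ℕ) (U : Finset V) :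
    (fiberFunctions R (a :: α) U).ncard =
      ∑ S ∈ U.powersetCard a, if R S then (fiberFunctions R α (U \ S)).ncard else 0 := by
  have hfib : ∀ S ⊆ U, ∀ f ∈ fiberFunctions R α (U \ S),
      fiber (fun v => if v ∈ U then f v + 1 else 0) 1 = S := by
    intro S hS f hf
    ext v
    have := hf.1 v
    rw [Finset.mem_sdiff] at this
    rw [mem_fiber]
    by_cases hv : v ∈ U
    · simp [hv, this]
    · simp only [hv, if_false]
      exact ⟨fun h => by omega, fun h => absurd (hS h) hv⟩
  let e : fiberFunctions R (a :: α) U ≃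
      Σ S : (U.powersetCard a).filter R, fiberFunctions R α (U \ S) :=
    { toFun := fun f => ⟨⟨fiber f.1 1, Finset.mem_filter.2
          ⟨(cons_mem_fiberFunctions.1 f.2).2.1, (cons_mem_fiberFunctions.1 f.2).2.2.1⟩⟩,
        ⟨_, (cons_mem_fiberFunctions.1 f.2).2.2.2⟩⟩
      -- Elements of S carry the value 0 and become 1; those of U \ S are shifted up; outside U the
      -- value stays 0.
      invFun := fun y => ⟨fun v => if v ∈ U then y.2.1 v + 1 else 0, by
        obtain ⟨⟨S, hS⟩, ⟨f, hf⟩⟩ := y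
        rw [Finset.mem_filter] at hS
        have h := hfib S (Finset.mem_powersetCard.1 hS.1).1 f hf
        refine cons_mem_fiberFunctions.2 ⟨fun v => ?_, ?_⟩
        · by_cases hv : v ∈ U <;> simp [hv]
        · simp only
          rw [h]
          refine ⟨hS.1, hS.2, ?_⟩
          convert hf using 1
          ext v
          by_cases hv : v ∈ U
          · simp [hv]
          · have := (hf.1 v).2 (by simp [hv])
            simp [hv, this]⟩
      left_inv := fun f => by
        ext v
        have := f.2.1 v
        by_cases hv : v ∈ U
        · simp only [hv, not_true, iff_false] at this
          simp only [hv, if_true]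
          omega
        · simp only [hv, if_false]
          exact (this.2 hv).symm
      right_inv := by
        rintro ⟨⟨S, hS⟩, ⟨f, hf⟩⟩
        have hS' := Finset.mem_filter.1 hS
        have h := hfib S (Finset.mem_powersetCard.1 hS'.1).1 f hf
        have h2 : (fun v => (if v ∈ U then f v + 1 else 0) - 1) = f := by
          ext v
          by_cases hv : v ∈ U
          · simp [hv]
          · have := (hf.1 v).2 (by simp [hv])
            simp [hv, this]
        exact Sigma.subtype_ext (Subtype.ext h) h2 }
  have hf : ∀ S : Finset V, Finite (fiberFunctions R α S) := fun S => finite_fiberFunctions R α S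
  rw [← Nat.card_coe_set_eq, Nat.card_congr e, Nat.card_sigma, ← Finset.sum_filter]
  simp only [Nat.card_coe_set_eq]
  exact Finset.sum_coe_sort ((U.powersetCard a).filter R)
    fun S => (fiberFunctions R α (U \ S)).ncard

open Classical in
-- The blocks exhaust U, so `q` is evaluated only at the empty set.
theorem weightSum_eq_ncard {R : Finset V → Prop} (hR : R ∅) {q : Finset V → ℚ} (hq : q ∅ = 1)
    (α : List ℕ) (U : Finset V) (hU : α.sum = U.card) :
    weightSum (fun S => if R S then 1 else 0) q α U = (fiberFunctions R α U).ncard := by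
  induction α generalizing U with
  | nil =>
    obtain rfl := Finset.card_eq_zero.1 hU.symm
    rw [weightSum, hq, fiberFunctions_nil hR, Set.ncard_singleton, Nat.cast_one]
  | cons a α ih =>
    rw [ncard_fiberFunctions_cons, weightSum]
    push_cast
    refine Finset.sum_congr rfl fun S hS => ?_
    obtain ⟨hS1, hS2⟩ := Finset.mem_powersetCard.1 hS
    split_ifs with h
    · rw [one_mul, ih]
      rw [Finset.card_sdiff_of_subset hS1, hS2, ← hU, List.sum_cons]; omega
    · rw [zero_mul]

open Classical in
-- The sign is multiplicative over disjoint stable sets, so each decomposition into stable blocks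
-- contributes the same sign, that of w on U.
theorem weightSum_signWeight {w : Equiv.Perm V} (α : List ℕ) {U : Finset V} (hw : Stable w U)
    (hU : α.sum = U.card) :
    weightSum (signWeight w) (stableWeight w) α U = signQ (restrictPerm w U) *
      (fiberFunctions (Stable w) α U).ncard := by
  rw [← weightSum_eq_ncard (stable_empty w) (perm_weightInverse w).right_empty α U hU]
  induction α generalizing U with
  | nil =>
    obtain rfl := Finset.card_eq_zero.1 hU.symm
    rw [restrictPerm_empty, signQ_one, one_mul]; rfl
  | cons a α ih =>
    simp only [weightSum, Finset.mul_sum]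
    refine Finset.sum_congr rfl fun S hS => ?_
    obtain ⟨hS1, hS2⟩ := Finset.mem_powersetCard.1 hS
    by_cases h : Stable w S
    · rw [ih (hw.sdiff h), signWeight, if_pos h, if_pos h, one_mul, ← mul_assoc, ← signQ_mul,
        ← restrictPerm_union h (hw.sdiff h) Finset.disjoint_sdiff,
        Finset.union_sdiff_of_subset hS1]
      rw [Finset.card_sdiff_of_subset hS1, hS2, ← hU, List.sum_cons]; omega
    · rw [signWeight, if_neg h, if_neg h]; ring

theorem fiberFunctions_univ_equiv (R : Finset V → Prop) (α : List ℕ) :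
    (fiberFunctions R α Finset.univ).ncard =
      {f : V → ℕ | ∀ i, R (fiber f i) ∧ (fiber f i).card = α.getD i 0}.ncard := by
  have h1 : ∀ (f : V → ℕ) i, fiber (fun v => f v + 1) (i + 1) = fiber f i := fun f i => by
    ext v; simp [mem_fiber]
  symm
  refine Set.ncard_congr (fun f _ v => f v + 1) ?_ ?_ ?_
  · intro f hf
    exact ⟨by simp, fun i => by rw [h1]; exact hf i⟩
  · intro f g _ _ h
    ext v
    have := congrFun h v
    omega
  · intro f hf
    have h2 : (fun v => (f v - 1) + 1) = f := by
      ext v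
      have := hf.1 v
      simp only [Finset.mem_univ, not_true, iff_false] at this
      omega
    refine ⟨fun v => f v - 1, fun i => ?_, h2⟩
    rw [← h1, h2]
    exact hf.2 i

theorem rowList_sum {n : ℕ} (μ : n.Partition) : (rowList μ).sum = n := (comp μ).blocks_sum

/-- A coloring of the incomparability graph is proper exactly when its color classes are chains. -/
theorem numColorings_incGraph {P : Type*} [PartialOrder P] [Fintype P] [DecidableEq P] {n : ℕ}
    (hP : Fintype.card P = n) (μ : n.Partition) :
    (numColorings (incGraph P) μ : ℚ) =
      weightSum increasingWeight descentFreeWeight (rowList μ) (Finset.univ : Finset P) := by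
  classical
  have h1 : (increasingWeight : Finset P → ℚ) =
      fun S : Finset P => if IsChain (· ≤ ·) (S : Set P) then (1 : ℚ) else 0 := by
    ext S; rw [increasingWeight_eq]
  rw [h1, weightSum_eq_ncard (R := fun S : Finset P => IsChain (· ≤ ·) (S : Set P)) (by simp)
    poset_weightInverse.right_empty _ _ (by rw [rowList_sum, Finset.card_univ, hP]),
    fiberFunctions_univ_equiv, numColorings, ← Nat.card_coe_set_eq]
  congr 1
  have h2 : ∀ (f : P → ℕ) i, Nat.card {v // f v = i} = (fiber f i).card := fun f i => by
    rw [fiber, ← Fintype.card_subtype, Nat.card_eq_fintype_card]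
  refine Nat.card_congr
    { toFun := fun κ => ⟨κ.1, fun i => ⟨?_, by rw [← κ.2 i]; exact (h2 _ i).symm⟩⟩
      invFun := fun f => ⟨SimpleGraph.Coloring.mk f.1 ?_, fun i => by
        rw [← (f.2 i).2]; exact h2 _ i⟩
      left_inv := fun κ => rfl
      right_inv := fun f => rfl }
  · intro x hx y hy hxy
    simp only [Finset.mem_coe, mem_fiber] at hx hy
    by_contra! h
    exact κ.1.valid (v := x) (w := y) ⟨h.1, h.2⟩ (hx.trans hy.symm)
  · intro x y hxy h
    have := (f.2 (f.1 x)).1 (x := x) (y := y) (by simp [mem_fiber]) (by simp [mem_fiber, h])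
      (by rintro rfl; exact hxy.1 le_rfl)
    exact this.elim hxy.1 hxy.2

end Counting

/-! ### The induced sign character as a weight sum -/

section InducedSign

variable {n : ℕ}

open Classical in
/-- Averaging over the orbit of a function under permutations of its arguments. -/
theorem sum_comp_perm {β : Type*} (f₀ : Fin n → β) (F : (Fin n → β) → ℚ) :
    ∑ g : Equiv.Perm (Fin n), F (fun x => f₀ (g⁻¹ x)) = Nat.card (fiberSubgroup f₀) *
      ∑ f ∈ Finset.univ.image fun (g : Equiv.Perm (Fin n)) x => f₀ (g⁻¹ x), F f := by
  rw [Finset.sum_comp F fun (g : Equiv.Perm (Fin n)) x => f₀ (g⁻¹ x), Finset.mul_sum]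
  refine Finset.sum_congr rfl fun f hf => ?_
  obtain ⟨g, -, rfl⟩ := Finset.mem_image.1 hf
  rw [nsmul_eq_mul]
  congr 2
  rw [← Fintype.card_subtype, ← Nat.card_eq_fintype_card]
  -- The permutations that move `f₀` to the same function as g does form a coset of the stabilizer;
  -- a ↦ a⁻¹ g identifies it with the stabilizer.
  refine Nat.card_congr (Equiv.subtypeEquiv ((Equiv.inv _).trans (Equiv.mulRight g)) fun a => ?_)
  rw [funext_iff]
  simp only [Equiv.trans_apply, Equiv.inv_apply, Equiv.coe_mulRight]
  change _ ↔ ∀ i, f₀ ((a⁻¹ * g) i) = f₀ i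
  constructor
  · intro h i
    rw [Equiv.Perm.mul_apply, h]
    exact congrArg f₀ (Equiv.symm_apply_apply g i)
  · intro h i
    have := h (g⁻¹ i)
    rwa [Equiv.Perm.mul_apply, show g (g⁻¹ i) = i from Equiv.apply_symm_apply g i] at this

theorem card_fiber_rowOf (μ : n.Partition) (i : ℕ) :
    (fiber (rowOf μ) i).card = (rowList μ).getD i 0 := by
  by_cases hi : i < (comp μ).length
  · have h : fiber (rowOf μ) i = Finset.univ.map ((comp μ).embedding ⟨i, hi⟩).toEmbedding := by
      ext v
      have := (comp μ).mem_range_embedding_iff' (j := v) (i := ⟨i, hi⟩)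
      rw [mem_fiber, rowOf]
      simp only [Finset.mem_map, Finset.mem_univ, true_and]
      rw [Set.mem_range] at this
      rw [show (∃ a, ((comp μ).embedding ⟨i, hi⟩).toEmbedding a = v) ↔ _ from this, Fin.ext_iff,
        eq_comm]
    rw [h, Finset.card_map, Finset.card_univ, Fintype.card_fin, Composition.blocksFun,
      show rowList μ = (comp μ).blocks from rfl, List.getD_eq_getElem _ _ hi]
    rfl
  · rw [show rowList μ = (comp μ).blocks from rfl, List.getD_eq_default _ _ (not_lt.1 hi), Finset.card_eq_zero,
      Finset.eq_empty_iff_forall_notMem]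
    intro v hv
    rw [mem_fiber] at hv
    exact hi (hv ▸ ((comp μ).index v).2)

/-- Conversely to the invariance of fibre sizes, bijections between fibres over the same value glue
to a permutation. -/
theorem mem_image_comp_perm {f₀ f : Fin n → ℕ} :
    (∃ g : Equiv.Perm (Fin n), (fun x => f₀ (g⁻¹ x)) = f) ↔
      ∀ i, (fiber f i).card = (fiber f₀ i).card := by
  constructor
  · rintro ⟨g, rfl⟩ i
    symm
    refine Finset.card_bij (fun v _ => g v) ?_ (fun _ _ _ _ h => g.injective h) ?_
    · intro v hv
      rw [mem_fiber] at hv ⊢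
      rw [← hv]; exact congrArg f₀ (Equiv.symm_apply_apply g v)
    · intro v hv
      exact ⟨g⁻¹ v, mem_fiber.2 ((mem_fiber (f := fun x => f₀ (g⁻¹ x))).1 hv), Equiv.apply_symm_apply g v⟩
  · intro h
    have e : ∀ i, Nonempty ({v // f v = i} ≃ {v // f₀ v = i}) := fun i => by
      refine Fintype.card_eq.1 ?_
      rw [Fintype.card_subtype, Fintype.card_subtype]
      exact h i
    let g : Equiv.Perm (Fin n) := (Equiv.sigmaFiberEquiv f).symm.trans
      ((Equiv.sigmaCongrRight fun i => (e i).some).trans (Equiv.sigmaFiberEquiv f₀))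
    refine ⟨g⁻¹, funext fun x => ?_⟩
    rw [inv_inv]
    exact ((e (f x)).some ⟨x, rfl⟩).2

/-- The conjugate g⁻¹wg lies in the Young subgroup iff w preserves the row function transported by
g. Grouping the g by the transported function cancels the factor 1/|𝔖_μ| and leaves sgn(w) times the
number of w-invariant functions with fibre sizes μ. -/
theorem epsilonChar_eq (μ : n.Partition) (w : Equiv.Perm (Fin n)) :
    epsilonChar μ w =
      weightSum (signWeight w) (stableWeight w) (rowList μ) Finset.univ := by
  classical
  rw [weightSum_signWeight _ (stable_univ w) (by rw [rowList_sum, Finset.card_univ,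
    Fintype.card_fin]), restrictPerm_univ, fiberFunctions_univ_equiv, epsilonChar, inducedFun]
  have h1 : ∀ g : Equiv.Perm (Fin n), (if g⁻¹ * w * g ∈ youngSubgroup μ then
      ((Equiv.Perm.sign (g⁻¹ * w * g) : ℤ) : ℚ) else 0) =
      (fun f : Fin n → ℕ => signQ w * if ∀ i, f (w i) = f i then 1 else 0)
        fun x => rowOf μ (g⁻¹ x) := by
    intro g
    have : g⁻¹ * w * g ∈ youngSubgroup μ ↔ ∀ i, rowOf μ (g⁻¹ (w i)) = rowOf μ (g⁻¹ i) := by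
      change (∀ i, rowOf μ ((g⁻¹ * w * g) i) = rowOf μ i) ↔ _
      constructor
      · intro h i
        have := h (g⁻¹ i)
        rwa [Equiv.Perm.mul_apply, show g (g⁻¹ i) = i from Equiv.apply_symm_apply g i] at this
      · intro h i
        have := h (g i)
        rwa [show g⁻¹ (g i) = i from Equiv.symm_apply_apply g i] at this
    simp only [this]
    split_ifs
    · rw [signQ, map_mul, map_mul, map_inv, mul_comm _ (Equiv.Perm.sign w), mul_assoc,
        inv_mul_cancel, mul_one, mul_one]
    · rw [mul_zero]
  have hcard : (Nat.card (youngSubgroup μ) : ℚ) ≠ 0 := Nat.cast_ne_zero.2 Nat.card_pos.ne'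
  rw [Finset.sum_congr rfl fun g _ => h1 g, sum_comp_perm (rowOf μ)
    fun f : Fin n → ℕ => signQ w * if ∀ i, f (w i) = f i then 1 else 0, ← mul_assoc]
  rw [show fiberSubgroup (rowOf μ) = youngSubgroup μ from rfl, inv_mul_cancel₀ hcard, one_mul,
    ← Finset.mul_sum, Finset.sum_boole]
  congr 2
  rw [← Set.ncard_coe_finset]
  congr 1
  ext f
  simp only [Finset.coe_filter, Finset.mem_image, Finset.mem_univ, true_and, Set.mem_ofPred_eq,
    mem_image_comp_perm, card_fiber_rowOf]
  rw [and_comm, forall_and]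
  refine and_congr_left fun _ => ⟨fun h i x => ?_, fun h x => ?_⟩
  · rw [mem_fiber, mem_fiber, h]
  · exact mem_fiber.1 ((h (f x) x).2 (mem_fiber.2 rfl))

end InducedSign

/-! ### Existence of group algebra elements with prescribed induced sign characters -/

section Existence

variable {n : ℕ}

/-- Let w permute each fibre in a single cycle; a w-invariant function is then constant on fibres.
-/
theorem exists_perm_orbits_eq_fibers (f₀ : Fin n → ℕ) :
    ∃ w : Equiv.Perm (Fin n), (∀ x, f₀ (w x) = f₀ x) ∧
      ∀ f : Fin n → ℕ, (∀ x, f (w x) = f x) → ∀ x y, f₀ x = f₀ y → f x = f y := by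
  classical
  have hc : ∀ i, ∃ c : Equiv.Perm {v // f₀ v = i}, ∀ x y, c.SameCycle x y := fun i => by
    obtain ⟨c, hc, -⟩ := Finset.exists_cycleOn (Finset.univ : Finset {v // f₀ v = i})
    exact ⟨c, fun x y => hc.2 (by simp) (by simp)⟩
  choose c hc using hc
  let w : Equiv.Perm (Fin n) := (Equiv.sigmaFiberEquiv f₀).symm.trans
    ((Equiv.sigmaCongrRight c).trans (Equiv.sigmaFiberEquiv f₀))
  have hw : ∀ i (x : {v // f₀ v = i}), w x = c i x := by
    rintro i ⟨x, rfl⟩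
    rfl
  refine ⟨w, fun x => ?_, fun f hf x y hxy => ?_⟩
  · rw [hw (f₀ x) ⟨x, rfl⟩]
    exact (c (f₀ x) ⟨x, rfl⟩).2
  · have hS : Stable (c (f₀ y)) (Finset.univ.filter fun v => f v = f x) := fun v => by
      simp only [Finset.mem_filter, Finset.mem_univ, true_and]
      rw [← hw, hf]
    have := (hS.sameCycle_mem (hc (f₀ y) ⟨x, hxy⟩ ⟨y, rfl⟩)).2 (by simp)
    exact (Finset.mem_filter.1 this).2.symm

theorem rowList_pos {μ : n.Partition} {a : ℕ} (ha : a ∈ rowList μ) : 0 < a :=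
  (comp μ).blocks_pos ha

theorem image_eq_range {μ : n.Partition} {f : Fin n → ℕ}
    (hf : ∀ i, (fiber f i).card = (rowList μ).getD i 0) :
    Finset.univ.image f = Finset.range (rowList μ).length := by
  ext i
  rw [Finset.mem_range]
  have h1 : i ∈ Finset.univ.image f ↔ 0 < (fiber f i).card := by
    rw [Finset.card_pos]
    simp [Finset.Nonempty, mem_fiber]
  rw [h1, hf]
  by_cases hi : i < (rowList μ).length
  · rw [List.getD_eq_getElem _ _ hi]
    simp [hi, rowList_pos (List.getElem_mem hi)]
  · rw [List.getD_eq_default _ _ (not_lt.1 hi)]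
    simp [hi]

theorem parts_eq_map_card_fiber {μ : n.Partition} {f : Fin n → ℕ}
    (hf : ∀ i, (fiber f i).card = (rowList μ).getD i 0) :
    μ.parts = (Finset.univ.image f).val.map fun i => (fiber f i).card := by
  have h : μ.parts = (rowList μ : Multiset ℕ) := by rw [rowList, Multiset.sort_eq]
  rw [image_eq_range hf, h, Finset.range_val, Multiset.range, Multiset.map_coe]
  congr 1
  refine List.ext_getElem (by simp) fun i hi _ => ?_
  simp [hf, hi]

theorem card_parts_eq_card_image {μ : n.Partition} {f : Fin n → ℕ}
    (hf : ∀ i, (fiber f i).card = (rowList μ).getD i 0) :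
    μ.parts.card = (Finset.univ.image f).card := by
  rw [parts_eq_map_card_fiber hf, Multiset.card_map, Finset.card_val]

/-- The function f factors as φ ∘ f₀. If φ is injective on the values of f₀, the fibres coincide;
otherwise f takes fewer values, and the number of values is the number of parts. -/
theorem coarsening {μ l : n.Partition} {f f₀ : Fin n → ℕ}
    (hf : ∀ i, (fiber f i).card = (rowList μ).getD i 0)
    (hf₀ : ∀ i, (fiber f₀ i).card = (rowList l).getD i 0)
    (h : ∀ x y, f₀ x = f₀ y → f x = f y) : μ = l ∨ μ.parts.card < l.parts.card := by
  obtain ⟨φ, hφ⟩ : ∃ φ : ℕ → ℕ, ∀ x, f x = φ (f₀ x) := by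
    have hfac : Function.FactorsThrough f f₀ := fun x y hxy => h x y hxy
    exact ⟨Function.extend f₀ f 0, fun x => (hfac.extend_apply 0 x).symm⟩
  have him : Finset.univ.image f = (Finset.univ.image f₀).image φ := by
    rw [Finset.image_image]
    exact Finset.image_congr fun x _ => hφ x
  rcases (Finset.card_image_le (s := Finset.univ.image f₀) (f := φ)).lt_or_eq with hlt | heq
  · right
    rwa [card_parts_eq_card_image hf, card_parts_eq_card_image hf₀, him]
  · left
    have hinj := Finset.card_image_iff.1 heq
    refine Nat.Partition.ext ?_
    rw [parts_eq_map_card_fiber hf, parts_eq_map_card_fiber hf₀, him,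
      Finset.image_val_of_injOn hinj, Multiset.map_map]
    refine Multiset.map_congr rfl fun i hi => ?_
    rw [Function.comp_apply]
    congr 1
    ext x
    rw [mem_fiber, mem_fiber, hφ]
    exact ⟨fun h => hinj (by simp) hi h, fun h => by rw [h]⟩

theorem epsilonChar_eq_ncard (μ : n.Partition) (w : Equiv.Perm (Fin n)) :
    epsilonChar μ w = signQ w *
      {f : Fin n → ℕ | ∀ i, Stable w (fiber f i) ∧ (fiber f i).card = (rowList μ).getD i 0}.ncard := by
  rw [epsilonChar_eq, weightSum_signWeight _ (stable_univ w) (by rw [rowList_sum,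
    Finset.card_univ, Fintype.card_fin]), restrictPerm_univ, fiberFunctions_univ_equiv]

theorem signQ_ne_zero {V : Type*} [Fintype V] [DecidableEq V] (w : Equiv.Perm V) :
    signQ w ≠ 0 := fun h => by
  have := signQ_mul_self w
  rw [h, mul_zero] at this
  exact zero_ne_one this

/-- Take w with the blocks of l as orbits. Up to sign ε^μ(w) counts w-invariant functions of type μ,
which are coarsenings of the row function of l: a triangular system, ordered by the number of parts.
-/
theorem exists_perm_epsilonChar (l : n.Partition) :
    ∃ w : Equiv.Perm (Fin n), epsilonChar l w ≠ 0 ∧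
      ∀ μ : n.Partition, epsilonChar μ w ≠ 0 → μ = l ∨ μ.parts.card < l.parts.card := by
  obtain ⟨w, hw1, hw2⟩ := exists_perm_orbits_eq_fibers (rowOf l)
  refine ⟨w, ?_, fun μ hμ => ?_⟩
  · rw [epsilonChar_eq_ncard]
    refine mul_ne_zero (signQ_ne_zero w) (Nat.cast_ne_zero.2 ?_)
    refine Set.ncard_ne_zero_of_mem (a := rowOf l) ?_ ?_
    · exact fun i => ⟨fun x => by rw [mem_fiber, mem_fiber, hw1], card_fiber_rowOf l i⟩
    -- `Set.ncard` is 0 on infinite sets, so finiteness is needed; the values are bounded by the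
    -- number of parts.
    · by_contra h
      refine h ((Set.Finite.pi' (t := fun _ : Fin n => Set.Iio (rowList l).length)
        fun _ => Set.finite_Iio _).subset fun f hf v => ?_)
      have := image_eq_range (μ := l) fun i => (hf i).2
      rw [Set.mem_Iio, ← Finset.mem_range, ← this]
      simp
  · rw [epsilonChar_eq_ncard] at hμ
    obtain ⟨f, hf⟩ := Set.nonempty_of_ncard_ne_zero (Nat.cast_ne_zero.1 (right_ne_zero_of_mul hμ))
    refine coarsening (fun i => (hf i).2) (card_fiber_rowOf l) (hw2 f fun x => ?_)
    exact mem_fiber.1 (((hf (f x)).1 x).2 (mem_fiber.2 rfl))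

theorem evalAlg_single (θ : Equiv.Perm (Fin n) → ℚ) (w : Equiv.Perm (Fin n)) :
    evalAlg θ (MonoidAlgebra.single w 1) = θ w := by
  classical
  simp [evalAlg, Finsupp.single_apply]

/-- The values of the induced sign characters on the group algebra. -/
def epsilonEval (n : ℕ) : GroupAlg n →ₗ[ℚ] (n.Partition → ℚ) where
  toFun D μ := evalAlg (epsilonChar μ) D
  map_add' D D' := by
    ext μ
    simp [evalAlg, add_mul, Finset.sum_add_distrib]
  map_smul' a D := by
    ext μ
    simp [evalAlg, Finset.mul_sum, mul_assoc]

open Classical in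
theorem single_mem_range_epsilonEval (l : n.Partition) :
    Pi.single l 1 ∈ LinearMap.range (epsilonEval n) := by
  induction hm : l.parts.card using Nat.strong_induction_on generalizing l with
  | _ m ih =>
    obtain ⟨w, hw1, hw2⟩ := exists_perm_epsilonChar l
    have h1 : epsilonEval n (MonoidAlgebra.single w 1) =
        ∑ μ, epsilonChar μ w • (Pi.single μ 1 : n.Partition → ℚ) := by
      ext μ
      simp [epsilonEval, evalAlg_single, Pi.single_apply]
    rw [← Finset.add_sum_erase _ _ (Finset.mem_univ l)] at h1
    have h2 : ∑ μ ∈ Finset.univ.erase l, epsilonChar μ w • (Pi.single μ 1 : n.Partition → ℚ) ∈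
        LinearMap.range (epsilonEval n) := by
      refine Submodule.sum_mem _ fun μ hμ => ?_
      by_cases h0 : epsilonChar μ w = 0
      · rw [h0, zero_smul]; exact Submodule.zero_mem _
      · refine Submodule.smul_mem _ _ (ih _ ?_ μ rfl)
        rw [← hm]
        exact (hw2 μ h0).resolve_left (Finset.ne_of_mem_erase hμ)
    have h3 : epsilonChar l w • (Pi.single l 1 : n.Partition → ℚ) ∈
        LinearMap.range (epsilonEval n) := by
      rw [eq_sub_of_add_eq h1.symm]
      exact Submodule.sub_mem _ (LinearMap.mem_range_self _ _) h2
    have := Submodule.smul_mem _ (epsilonChar l w)⁻¹ h3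
    rwa [smul_smul, inv_mul_cancel₀ hw1, one_smul] at this

theorem exists_evalAlg_epsilonChar (t : n.Partition → ℚ) :
    ∃ D : GroupAlg n, ∀ μ, evalAlg (epsilonChar μ) D = t μ := by
  classical
  have h : t ∈ LinearMap.range (epsilonEval n) := by
    have : t = ∑ μ, t μ • (Pi.single μ 1 : n.Partition → ℚ) := by
      ext μ
      simp [Pi.single_apply]
    rw [this]
    exact Submodule.sum_mem _ fun μ _ =>
      Submodule.smul_mem _ _ (single_mem_range_epsilonEval μ)
  obtain ⟨D, hD⟩ := h
  exact ⟨D, fun μ => congrFun hD μ⟩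

/-! ### Comparing coefficients of monomial symmetric functions -/

theorem exists_exponent (μ : n.Partition) :
    ∃ d : ℕ →₀ ℕ, d.support.val.map d = μ.parts := by
  let d : ℕ →₀ ℕ := Finsupp.ofSupportFinite (fiber (rowOf μ) · |>.card) (by
    refine (Finset.univ.image (rowOf μ)).finite_toSet.subset fun i hi => ?_
    obtain ⟨v, hv⟩ := Finset.card_pos.1 (Nat.pos_of_ne_zero hi)
    simpa using ⟨v, mem_fiber.1 hv⟩)
  refine ⟨d, ?_⟩
  rw [parts_eq_map_card_fiber (card_fiber_rowOf μ)]
  have : d.support = Finset.univ.image (rowOf μ) := by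
    ext i
    rw [Finsupp.mem_support_iff]
    change (fiber (rowOf μ) i).card ≠ 0 ↔ _
    rw [← Nat.pos_iff_ne_zero, Finset.card_pos]
    simp [Finset.Nonempty, mem_fiber]
  rw [this]
  rfl

theorem sum_smul_monomialSymm_inj {a b : n.Partition → ℚ} :
    (∑ μ, a μ • monomialSymm μ = ∑ μ, b μ • monomialSymm μ) ↔ ∀ μ, a μ = b μ := by
  classical
  refine ⟨fun h μ => ?_, fun h => by simp only [h]⟩
  obtain ⟨d, hd⟩ := exists_exponent μ
  have key : ∀ a : n.Partition → ℚ,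
      MvPowerSeries.coeff d (∑ μ, a μ • monomialSymm μ) = a μ := by
    intro a
    have h1 : ∀ ν : n.Partition, MvPowerSeries.coeff d (monomialSymm ν) =
        if μ = ν then 1 else 0 := by
      intro ν
      change (if d.support.val.map d = ν.parts then (1 : ℚ) else 0) = _
      rw [hd]
      simp only [Nat.Partition.ext_iff]
    simp [map_sum, h1]
  rw [← key a, h, key]

theorem symmGen_eq_chromSymm_iff {V : Type*} {G : SimpleGraph V} {D : GroupAlg n} :
    symmGen D = chromSymm n G ↔ ∀ μ, evalAlg (epsilonChar μ) D = numColorings G μ :=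
  sum_smul_monomialSymm_inj

end Existence

/-! ### Twisted sums over symmetric groups of subsets -/

section TwistedSums

set_option linter.unusedSectionVars false

variable {n : ℕ}

/-- The basis element of the group algebra belonging to a permutation. -/
def el (w : Equiv.Perm (Fin n)) : GroupAlg n := MonoidAlgebra.single w 1

theorem el_mul (v w : Equiv.Perm (Fin n)) : el (v * w) = el v * el w := by
  simp [el]

theorem el_one : el (1 : Equiv.Perm (Fin n)) = 1 := rfl

open Classical in
/-- The permutations that fix all elements outside `S`. -/
def permsOf (S : Finset (Fin n)) : Finset (Equiv.Perm (Fin n)) :=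
  Finset.univ.filter fun p => ∀ x, x ∉ S → p x = x

theorem mem_permsOf {S : Finset (Fin n)} {p : Equiv.Perm (Fin n)} :
    p ∈ permsOf S ↔ ∀ x, x ∉ S → p x = x := by simp [permsOf]

theorem mul_mem_permsOf {S : Finset (Fin n)} {p q : Equiv.Perm (Fin n)} (hp : p ∈ permsOf S)
    (hq : q ∈ permsOf S) : p * q ∈ permsOf S := by
  rw [mem_permsOf] at *
  intro x hx
  rw [Equiv.Perm.mul_apply, hq x hx, hp x hx]

theorem inv_mem_permsOf {S : Finset (Fin n)} {p : Equiv.Perm (Fin n)} (hp : p ∈ permsOf S) :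
    p⁻¹ ∈ permsOf S := by
  rw [mem_permsOf] at *
  intro x hx
  rw [Equiv.Perm.inv_eq_iff_eq, hp x hx]

theorem swap_mem_permsOf {S : Finset (Fin n)} {x y : Fin n} (hx : x ∈ S) (hy : y ∈ S) :
    Equiv.swap x y ∈ permsOf S := by
  rw [mem_permsOf]
  intro z hz
  exact Equiv.swap_apply_of_ne_of_ne (fun h => hz (h ▸ hx)) (fun h => hz (h ▸ hy))

theorem permsOf_mono {S T : Finset (Fin n)} (h : S ⊆ T) : permsOf S ⊆ permsOf T := by
  intro p hp
  rw [mem_permsOf] at *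
  exact fun x hx => hp x fun hS => hx (h hS)

theorem mem_iff_of_mem_permsOf {S : Finset (Fin n)} {p : Equiv.Perm (Fin n)} (hp : p ∈ permsOf S)
    (x : Fin n) : p x ∈ S ↔ x ∈ S := by
  rw [mem_permsOf] at hp
  constructor
  · intro h
    by_contra hx
    rw [hp x hx] at h
    exact hx h
  · intro h
    by_contra hx
    have := p.injective (hp _ hx)
    rw [this] at hx
    exact hx h

theorem card_permsOf (S : Finset (Fin n)) : (permsOf S).card = S.card.factorial := by
  classical
  rw [permsOf, ← Fintype.card_subtype, ← Fintype.card_coe S, ← Fintype.card_perm]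
  exact Fintype.card_congr (Equiv.Perm.subtypeEquivSubtypePerm fun x => x ∈ S).symm

theorem mul_comm_of_permsOf {S T : Finset (Fin n)} (hd : Disjoint S T)
    {p q : Equiv.Perm (Fin n)} (hp : p ∈ permsOf S) (hq : q ∈ permsOf T) : p * q = q * p := by
  rw [mem_permsOf] at hp hq
  refine Equiv.Perm.Disjoint.commute fun x => ?_
  by_cases hx : x ∈ S
  · exact Or.inr (hq x fun h => Finset.disjoint_left.1 hd hx h)
  · exact Or.inl (hp x hx)

/-- The sum of the permutations of `S`, weighted by a linear character. -/
def twistedSum (χ : Equiv.Perm (Fin n) →* ℚ) (S : Finset (Fin n)) : GroupAlg n :=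
  ∑ p ∈ permsOf S, χ p • el p

variable (χ χ' : Equiv.Perm (Fin n) →* ℚ)

theorem el_mul_twistedSum {S : Finset (Fin n)} {p : Equiv.Perm (Fin n)} (hp : p ∈ permsOf S) :
    el p * twistedSum χ S = χ p⁻¹ • twistedSum χ S := by
  rw [twistedSum, Finset.mul_sum, Finset.smul_sum]
  refine Finset.sum_bij' (fun q _ => p * q) (fun q _ => p⁻¹ * q)
    (fun q hq => mul_mem_permsOf hp hq) (fun q hq => mul_mem_permsOf (inv_mem_permsOf hp) hq)
    (fun q _ => by group) (fun q _ => by group) fun q _ => ?_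
  rw [mul_smul_comm, ← el_mul, smul_smul, ← map_mul, inv_mul_cancel_left]

theorem twistedSum_mul_el {S : Finset (Fin n)} {p : Equiv.Perm (Fin n)} (hp : p ∈ permsOf S) :
    twistedSum χ S * el p = χ p⁻¹ • twistedSum χ S := by
  rw [twistedSum, Finset.sum_mul, Finset.smul_sum]
  refine Finset.sum_bij' (fun q _ => q * p) (fun q _ => q * p⁻¹)
    (fun q hq => mul_mem_permsOf hq hp) (fun q hq => mul_mem_permsOf hq (inv_mem_permsOf hp))
    (fun q _ => by group) (fun q _ => by group) fun q _ => ?_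
  rw [smul_mul_assoc, ← el_mul, smul_smul, map_mul, mul_left_comm, ← map_mul, inv_mul_cancel,
    map_one, mul_one]

theorem el_commute_twistedSum {S T : Finset (Fin n)} (hd : Disjoint S T)
    {p : Equiv.Perm (Fin n)} (hp : p ∈ permsOf S) :
    el p * twistedSum χ T = twistedSum χ T * el p := by
  rw [twistedSum, Finset.mul_sum, Finset.sum_mul]
  refine Finset.sum_congr rfl fun q hq => ?_
  rw [mul_smul_comm, smul_mul_assoc, ← el_mul, ← el_mul, mul_comm_of_permsOf hd hp hq]

theorem twistedSum_commute {S T : Finset (Fin n)} (hd : Disjoint S T) :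
    twistedSum χ S * twistedSum χ' T = twistedSum χ' T * twistedSum χ S := by
  rw [twistedSum, Finset.mul_sum, Finset.sum_mul]
  refine Finset.sum_congr rfl fun q hq => ?_
  rw [mul_smul_comm, smul_mul_assoc, el_commute_twistedSum χ' hd hq]

theorem twistedSum_mul_of_subset {S T : Finset (Fin n)} (h : S ⊆ T) :
    twistedSum χ S * twistedSum χ T = (S.card.factorial : ℚ) • twistedSum χ T := by
  rw [twistedSum, Finset.sum_mul, ← card_permsOf, Nat.cast_smul_eq_nsmul, ← Finset.sum_const]
  refine Finset.sum_congr rfl fun q hq => ?_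
  rw [smul_mul_assoc, el_mul_twistedSum χ (permsOf_mono h hq), smul_smul, ← map_mul,
    mul_inv_cancel, map_one, one_smul]

theorem twistedSum_mul_of_superset {S T : Finset (Fin n)} (h : S ⊆ T) :
    twistedSum χ T * twistedSum χ S = (S.card.factorial : ℚ) • twistedSum χ T := by
  rw [twistedSum, twistedSum, Finset.mul_sum, ← card_permsOf, Nat.cast_smul_eq_nsmul,
    ← Finset.sum_const]
  refine Finset.sum_congr rfl fun q hq => ?_
  rw [mul_smul_comm, ← twistedSum, twistedSum_mul_el χ (permsOf_mono h hq), smul_smul, ← map_mul,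
    mul_inv_cancel, map_one, one_smul]

theorem el_mul_twistedSum_conj {S T : Finset (Fin n)} {p : Equiv.Perm (Fin n)}
    (h : ∀ x, p x ∈ T ↔ x ∈ S) : el p * twistedSum χ S = twistedSum χ T * el p := by
  rw [twistedSum, twistedSum, Finset.mul_sum, Finset.sum_mul]
  refine Finset.sum_bij' (fun q _ => p * q * p⁻¹) (fun q _ => p⁻¹ * q * p) ?_ ?_
    (fun q _ => by group) (fun q _ => by group) fun q _ => ?_
  · intro q hq
    rw [mem_permsOf] at *
    intro x hx
    rw [Equiv.Perm.mul_apply, Equiv.Perm.mul_apply, hq, show p (p⁻¹ x) = x from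
      Equiv.apply_symm_apply p x]
    rw [← h, show p (p⁻¹ x) = x from Equiv.apply_symm_apply p x]
    exact hx
  · intro q hq
    rw [mem_permsOf] at *
    intro x hx
    rw [Equiv.Perm.mul_apply, Equiv.Perm.mul_apply, hq _ (by rwa [h]),
      show p⁻¹ (p x) = x from Equiv.symm_apply_apply p x]
  · rw [mul_smul_comm, smul_mul_assoc, ← el_mul, ← el_mul, inv_mul_cancel_right, map_mul, map_mul,
      mul_comm (χ p), mul_assoc, ← map_mul, mul_inv_cancel, map_one, mul_one]

/-- Coset decomposition: the coset of p is determined by i = p a, with the swap of a and i as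
representative. -/
theorem twistedSum_insert_left {a : Fin n} {S : Finset (Fin n)} (ha : a ∉ S) :
    twistedSum χ (insert a S) = twistedSum χ S +
      ∑ i ∈ S, χ (Equiv.swap a i) • (el (Equiv.swap a i) * twistedSum χ S) := by
  have h : twistedSum χ (insert a S) =
      ∑ i ∈ insert a S, χ (Equiv.swap a i) • (el (Equiv.swap a i) * twistedSum χ S) := by
    simp only [twistedSum, Finset.mul_sum, Finset.smul_sum]
    rw [← Finset.sum_product']
    symm
    refine Finset.sum_bij' (fun x _ => Equiv.swap a x.1 * x.2)
      (fun p _ => (p a, Equiv.swap a (p a) * p)) ?_ ?_ ?_ ?_ ?_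
    · rintro ⟨i, p⟩ hp
      rw [Finset.mem_product] at hp
      exact mul_mem_permsOf (swap_mem_permsOf (Finset.mem_insert_self a S) hp.1)
        (permsOf_mono (Finset.subset_insert a S) hp.2)
    · intro p hp
      have hpa : p a ∈ insert a S := (mem_iff_of_mem_permsOf hp a).2 (Finset.mem_insert_self a S)
      rw [Finset.mem_product]
      refine ⟨hpa, mem_permsOf.2 fun x hx => ?_⟩
      by_cases hxa : x = a
      · subst hxa; simp
      · exact mem_permsOf.1 (mul_mem_permsOf (swap_mem_permsOf (Finset.mem_insert_self a S) hpa)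
          hp) x (by simp [hx, hxa])
    · rintro ⟨i, p⟩ hp
      rw [Finset.mem_product] at hp
      have hpa := mem_permsOf.1 hp.2 a ha
      simp [hpa]
    · intro p hp
      simp
    · rintro ⟨i, p⟩ hp
      rw [mul_smul_comm, smul_smul, el_mul, map_mul]
  rw [h, Finset.sum_insert ha, Equiv.swap_self]
  congr 1
  rw [show Equiv.refl (Fin n) = 1 from rfl, map_one, one_smul, el_one, one_mul]

/-- The cosets on the other side, determined by i = p⁻¹ a. -/
theorem twistedSum_insert_right {a : Fin n} {S : Finset (Fin n)} (ha : a ∉ S) :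
    twistedSum χ (insert a S) = twistedSum χ S +
      ∑ i ∈ S, χ (Equiv.swap a i) • (twistedSum χ S * el (Equiv.swap a i)) := by
  have h : twistedSum χ (insert a S) =
      ∑ i ∈ insert a S, χ (Equiv.swap a i) • (twistedSum χ S * el (Equiv.swap a i)) := by
    simp only [twistedSum, Finset.sum_mul, Finset.smul_sum]
    rw [← Finset.sum_product']
    symm
    refine Finset.sum_bij' (fun x _ => x.2 * Equiv.swap a x.1)
      (fun p _ => (p⁻¹ a, p * Equiv.swap a (p⁻¹ a))) ?_ ?_ ?_ ?_ ?_
    · rintro ⟨i, p⟩ hp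
      rw [Finset.mem_product] at hp
      exact mul_mem_permsOf (permsOf_mono (Finset.subset_insert a S) hp.2)
        (swap_mem_permsOf (Finset.mem_insert_self a S) hp.1)
    · intro p hp
      have hpa : p⁻¹ a ∈ insert a S :=
        (mem_iff_of_mem_permsOf (inv_mem_permsOf hp) a).2 (Finset.mem_insert_self a S)
      rw [Finset.mem_product]
      refine ⟨hpa, mem_permsOf.2 fun x hx => ?_⟩
      by_cases hxa : x = a
      · subst hxa
        rw [Equiv.Perm.mul_apply, Equiv.swap_apply_left]
        exact Equiv.apply_symm_apply p x
      · exact mem_permsOf.1 (mul_mem_permsOf hp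
          (swap_mem_permsOf (Finset.mem_insert_self a S) hpa)) x (by simp [hx, hxa])
    · rintro ⟨i, p⟩ hp
      rw [Finset.mem_product] at hp
      have hpa := mem_permsOf.1 (inv_mem_permsOf hp.2) a ha
      have : (p * Equiv.swap a i)⁻¹ a = i := by
        rw [mul_inv_rev, Equiv.Perm.mul_apply, hpa, Equiv.swap_inv, Equiv.swap_apply_left]
      simp only [this, mul_assoc, Equiv.swap_mul_self, mul_one]
    · intro p hp
      simp only [mul_assoc, Equiv.swap_mul_self, mul_one]
    · rintro ⟨i, p⟩ hp
      rw [smul_mul_assoc, smul_smul, el_mul, map_mul, mul_comm]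
  rw [h, Finset.sum_insert ha, Equiv.swap_self]
  congr 1
  rw [show Equiv.refl (Fin n) = 1 from rfl, map_one, one_smul, el_one, mul_one]

/-- The sum of the permutations of `S`. -/
def symSum (S : Finset (Fin n)) : GroupAlg n := twistedSum 1 S

/-- The sign character as a homomorphism to the rational numbers. -/
def signHom (n : ℕ) : Equiv.Perm (Fin n) →* ℚ :=
  ((Int.castRingHom ℚ : ℤ →* ℚ).comp (Units.coeHom ℤ)).comp Equiv.Perm.sign

theorem signHom_apply (w : Equiv.Perm (Fin n)) : signHom n w = signQ w := rfl

theorem signHom_swap {x y : Fin n} (h : x ≠ y) : signHom n (Equiv.swap x y) = -1 := by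
  rw [signHom_apply, signQ, Equiv.Perm.sign_swap h]; simp

/-- The alternating sum of the permutations of `S`. -/
def altSum (S : Finset (Fin n)) : GroupAlg n := twistedSum (signHom n) S

theorem altSum_mul_swap {S : Finset (Fin n)} {x y : Fin n} (hx : x ∈ S) (hy : y ∈ S)
    (h : x ≠ y) : altSum S * el (Equiv.swap x y) = - altSum S := by
  rw [altSum, twistedSum_mul_el _ (swap_mem_permsOf hx hy), Equiv.swap_inv, signHom_swap h,
    neg_one_smul]

theorem swap_mul_altSum {S : Finset (Fin n)} {x y : Fin n} (hx : x ∈ S) (hy : y ∈ S)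
    (h : x ≠ y) : el (Equiv.swap x y) * altSum S = - altSum S := by
  rw [altSum, el_mul_twistedSum _ (swap_mem_permsOf hx hy), Equiv.swap_inv, signHom_swap h,
    neg_one_smul]

theorem symSum_mul_swap {S : Finset (Fin n)} {x y : Fin n} (hx : x ∈ S) (hy : y ∈ S) :
    symSum S * el (Equiv.swap x y) = symSum S := by
  rw [symSum, twistedSum_mul_el _ (swap_mem_permsOf hx hy), MonoidHom.one_apply, one_smul]

theorem swap_mul_symSum {S : Finset (Fin n)} {x y : Fin n} (hx : x ∈ S) (hy : y ∈ S) :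
    el (Equiv.swap x y) * symSum S = symSum S := by
  rw [symSum, el_mul_twistedSum _ (swap_mem_permsOf hx hy), MonoidHom.one_apply, one_smul]

theorem swap_mul_swap_eq {a i j : Fin n} (hai : a ≠ i) (hij : i ≠ j) :
    Equiv.swap a i * Equiv.swap a j = Equiv.swap a j * Equiv.swap i j := by
  ext x
  simp only [Equiv.Perm.mul_apply, Equiv.swap_apply_def]
  grind

theorem swap_mul_swap_mul_swap_eq {a i j : Fin n} (haj : a ≠ j) (hij : i ≠ j) :
    Equiv.swap a i * Equiv.swap a j * Equiv.swap a i = Equiv.swap i j := by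
  ext x
  simp only [Equiv.Perm.mul_apply, Equiv.swap_apply_def]
  grind

/-- From (a i)(a j) = (a j)(i j), the alternating sum absorbs (a j) with a sign. From (a i)(a j)(a
i) = (i j), the symmetric sum absorbs (a i) without one. So the product is both plus and minus the
same element. -/
theorem altSum_mul_swap_mul_swap_mul_symSum {X Y : Finset (Fin n)} {a i j : Fin n} (haX : a ∈ X)
    (haY : a ∈ Y) (hi : i ∈ X) (hj : j ∈ Y) (hai : a ≠ i) (haj : a ≠ j) (hij : i ≠ j) :
    altSum Y * el (Equiv.swap a i) * el (Equiv.swap a j) * symSum X = 0 := by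
  have h1 : altSum Y * el (Equiv.swap a i) * el (Equiv.swap a j) * symSum X =
      - (altSum Y * el (Equiv.swap i j) * symSum X) := by
    rw [mul_assoc (altSum Y), ← el_mul, swap_mul_swap_eq hai hij, el_mul, ← mul_assoc,
      altSum_mul_swap haY hj haj, neg_mul, neg_mul]
  have h2 : altSum Y * el (Equiv.swap a i) * el (Equiv.swap a j) * symSum X =
      altSum Y * el (Equiv.swap i j) * symSum X := by
    rw [← swap_mul_swap_mul_swap_eq haj hij, el_mul, el_mul, mul_assoc (altSum Y),
      mul_assoc (altSum Y), mul_assoc (altSum Y), mul_assoc (el _ * el _), swap_mul_symSum haX hi]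
  have h3 := h1.symm.trans h2
  have h4 : (2 : ℚ) • (altSum Y * el (Equiv.swap i j) * symSum X) = 0 := by
    rw [two_smul]
    nth_rewrite 1 [← h3]
    exact neg_add_cancel _
  rw [h2, (smul_eq_zero.1 h4).resolve_left two_ne_zero]

/-- The symmetrizer of a hook is a multiple of an idempotent. -/
theorem hookSymmetrizer_mul_self {X Y : Finset (Fin n)} {a : Fin n} (haX : a ∉ X) (haY : a ∉ Y)
    (hd : Disjoint X Y) :
    altSum (insert a Y) * symSum (insert a X) * (altSum (insert a Y) * symSum (insert a X)) =
      (((X.card + Y.card + 1) * X.card.factorial * Y.card.factorial : ℕ) : ℚ) •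
        (altSum (insert a Y) * symSum (insert a X)) := by
  set B := altSum (insert a Y) with hB
  set R := symSum (insert a X) with hR
  have hXR : symSum X * R = (X.card.factorial : ℚ) • R :=
    twistedSum_mul_of_subset 1 (Finset.subset_insert a X)
  have hXB : symSum X * B = B * symSum X := by
    refine twistedSum_commute 1 (signHom n) ?_
    rw [Finset.disjoint_insert_right]
    exact ⟨haX, hd⟩
  have hBY : B * altSum Y = (Y.card.factorial : ℚ) • B :=
    twistedSum_mul_of_superset (signHom n) (Finset.subset_insert a Y)
  have hBB : B * B = ((Y.card + 1).factorial : ℚ) • B := by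
    have := twistedSum_mul_of_subset (signHom n) (Finset.Subset.refl (insert a Y))
    rwa [Finset.card_insert_of_notMem haY] at this
  -- Expand the second B over its cosets. The swap (a i) commutes with the alternating sum over Y,
  -- and all terms with a second swap (a j) vanish by the preceding lemma.
  have hterm : ∀ i ∈ X, B * el (Equiv.swap a i) * (B * R) = (Y.card.factorial : ℚ) • (B * R) := by
    intro i hi
    have hai : a ≠ i := fun h => haX (h ▸ hi)
    have hcomm : el (Equiv.swap a i) * altSum Y = altSum Y * el (Equiv.swap a i) := by
      refine el_commute_twistedSum (signHom n) (S := insert a X) ?_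
        (swap_mem_permsOf (Finset.mem_insert_self a X) (Finset.mem_insert_of_mem hi))
      rw [Finset.disjoint_insert_left]
      exact ⟨haY, hd⟩
    have hexp : B = altSum Y + ∑ j ∈ Y, signHom n (Equiv.swap a j) •
        (altSum Y * el (Equiv.swap a j)) := twistedSum_insert_right (signHom n) haY
    have hzero : ∀ j ∈ Y, B * el (Equiv.swap a i) * (altSum Y * el (Equiv.swap a j) * R) = 0 := by
      intro j hj
      have h0 := altSum_mul_swap_mul_swap_mul_symSum (Finset.mem_insert_self a X)
        (Finset.mem_insert_self a Y) (Finset.mem_insert_of_mem hi) (Finset.mem_insert_of_mem hj)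
        hai (fun h => haY (h ▸ hj)) (fun h => Finset.disjoint_left.1 hd hi (h ▸ hj))
      calc B * el (Equiv.swap a i) * (altSum Y * el (Equiv.swap a j) * R)
          = B * (el (Equiv.swap a i) * altSum Y) * el (Equiv.swap a j) * R := by
            simp only [mul_assoc]
        _ = (B * altSum Y) * el (Equiv.swap a i) * el (Equiv.swap a j) * R := by
            rw [hcomm]; simp only [mul_assoc]
        _ = 0 := by
            rw [hBY, smul_mul_assoc, smul_mul_assoc, smul_mul_assoc, h0, smul_zero]
    calc B * el (Equiv.swap a i) * (B * R)
        = B * el (Equiv.swap a i) * (altSum Y * R) + ∑ j ∈ Y, signHom n (Equiv.swap a j) •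
            (B * el (Equiv.swap a i) * (altSum Y * el (Equiv.swap a j) * R)) := by
          conv_lhs => rw [show B * R = (altSum Y + ∑ j ∈ Y, signHom n (Equiv.swap a j) •
            (altSum Y * el (Equiv.swap a j))) * R from by rw [← hexp]]
          rw [add_mul, mul_add, Finset.sum_mul, Finset.mul_sum]
          simp only [smul_mul_assoc, mul_smul_comm]
      _ = B * el (Equiv.swap a i) * (altSum Y * R) := by
          rw [Finset.sum_eq_zero fun j hj => by rw [hzero j hj, smul_zero], add_zero]
      _ = B * (el (Equiv.swap a i) * altSum Y) * R := by simp only [mul_assoc]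
      _ = (B * altSum Y) * (el (Equiv.swap a i) * R) := by rw [hcomm]; simp only [mul_assoc]
      _ = (Y.card.factorial : ℚ) • (B * R) := by
          rw [hBY, swap_mul_symSum (Finset.mem_insert_self a X) (Finset.mem_insert_of_mem hi),
            smul_mul_assoc]
  -- Now the first R is expanded: the sum over X commutes with B and is absorbed by the second R,
  -- which gives |X|!.
  have hRexp : R = symSum X + ∑ i ∈ X, el (Equiv.swap a i) * symSum X := by
    rw [hR, symSum, twistedSum_insert_left 1 haX]
    simp only [MonoidHom.one_apply, one_smul, symSum]
  calc B * R * (B * R)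
      = B * (symSum X * B * R) + ∑ i ∈ X, B * el (Equiv.swap a i) * (symSum X * B * R) := by
        conv_lhs => rw [show B * R * (B * R) =
          B * (symSum X + ∑ i ∈ X, el (Equiv.swap a i) * symSum X) * (B * R) from by rw [← hRexp]]
        rw [mul_add, add_mul, Finset.mul_sum, Finset.sum_mul]
        simp only [mul_assoc]
    _ = (X.card.factorial : ℚ) • (B * B * R + ∑ i ∈ X, B * el (Equiv.swap a i) * (B * R)) := by
        rw [hXB, mul_assoc B (symSum X), hXR, mul_smul_comm, smul_add, Finset.smul_sum]
        simp only [mul_smul_comm, mul_assoc]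
    _ = _ := by
        -- The identity coset gives (|Y|+1)! and each of the |X| swaps gives |Y|!, in total
        -- (|X|+|Y|+1) |Y|!.
        rw [Finset.sum_congr rfl hterm, hBB, Finset.sum_const, smul_mul_assoc,
          ← Nat.cast_smul_eq_nsmul ℚ, smul_smul, ← add_smul, smul_smul]
        congr 1
        rw [Nat.factorial_succ]
        push_cast
        ring

end TwistedSums

/-! ### Traces on the group algebra -/

section Traces

set_option linter.unusedSectionVars false

variable {n : ℕ}

/-- The trace of `x ↦ w x u` on the group algebra, as a function of `u`. -/
def twoSidedTrace (w : Equiv.Perm (Fin n)) : GroupAlg n →ₗ[ℚ] ℚ :=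
  LinearMap.trace ℚ (GroupAlg n) ∘ₗ
    LinearMap.llcomp ℚ (GroupAlg n) (GroupAlg n) (GroupAlg n) (LinearMap.mulLeft ℚ (el w)) ∘ₗ
      (LinearMap.mul ℚ (GroupAlg n)).flip

theorem twoSidedTrace_apply (w : Equiv.Perm (Fin n)) (u : GroupAlg n) :
    twoSidedTrace w u = LinearMap.trace ℚ (GroupAlg n)
      (LinearMap.mulLeft ℚ (el w) ∘ₗ LinearMap.mulRight ℚ u) := rfl

theorem twoSidedTrace_mul_comm (w : Equiv.Perm (Fin n)) (u v : GroupAlg n) :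
    twoSidedTrace w (u * v) = twoSidedTrace w (v * u) := by
  rw [twoSidedTrace_apply, twoSidedTrace_apply]
  have h1 : LinearMap.mulLeft ℚ (el w) ∘ₗ LinearMap.mulRight ℚ (u * v) =
      LinearMap.mulRight ℚ v ∘ₗ (LinearMap.mulLeft ℚ (el w) ∘ₗ LinearMap.mulRight ℚ u) := by
    refine LinearMap.ext fun x => ?_
    simp [mul_assoc]
  have h2 : LinearMap.mulLeft ℚ (el w) ∘ₗ LinearMap.mulRight ℚ (v * u) =
      (LinearMap.mulLeft ℚ (el w) ∘ₗ LinearMap.mulRight ℚ u) ∘ₗ LinearMap.mulRight ℚ v := by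
    refine LinearMap.ext fun x => ?_
    simp [mul_assoc]
  rw [h1, h2, LinearMap.trace_comp_comm']

/-- In the basis of permutations the diagonal entry at g is the coefficient of g in w g u, and w g m
= g means m = g⁻¹w⁻¹g. -/
theorem twoSidedTrace_eq_sum (w : Equiv.Perm (Fin n)) (u : GroupAlg n) :
    twoSidedTrace w u = ∑ g : Equiv.Perm (Fin n), u.coeff (g⁻¹ * w⁻¹ * g) := by
  classical
  rw [twoSidedTrace_apply, LinearMap.trace_eq_matrix_trace ℚ
    (MonoidAlgebra.basis (Equiv.Perm (Fin n)) ℚ), Matrix.trace]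
  refine Finset.sum_congr rfl fun g _ => ?_
  rw [Matrix.diag_apply, LinearMap.toMatrix_apply]
  change (el w * (MonoidAlgebra.single g 1 * u)).coeff g = _
  rw [← mul_assoc, el, MonoidAlgebra.single_mul_single,
    MonoidAlgebra.coeff_single_mul_eq_mul_coeff (g⁻¹ * w⁻¹ * g)]
  · simp
  · intro m _
    constructor
    · intro h
      calc m = (w * g)⁻¹ * (w * g * m) := by group
        _ = _ := by rw [h, mul_inv_rev]
    · rintro rfl
      group

/-- The trace on a left ideal generated by a multiple of an idempotent. -/
theorem trace_restrict_range_mulRight {c : GroupAlg n} {m : ℚ} (hc : c * c = m • c)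
    (w : Equiv.Perm (Fin n))
    (h : ∀ x ∈ LinearMap.range (LinearMap.mulRight ℚ c),
      LinearMap.mulLeft ℚ (el w) x ∈ LinearMap.range (LinearMap.mulRight ℚ c)) :
    m * LinearMap.trace ℚ _ ((LinearMap.mulLeft ℚ (el w)).restrict h) = twoSidedTrace w c := by
  set W := LinearMap.range (LinearMap.mulRight ℚ c)
  set A := (LinearMap.mulLeft ℚ (el w)).restrict h
  -- The operator factors through the left ideal W. Composed in the other order, right
  -- multiplication by c acts on W as the scalar m, because the elements of W have the form y c.
  have h1 : LinearMap.mulLeft ℚ (el w) ∘ₗ LinearMap.mulRight ℚ c =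
      (W.subtype ∘ₗ A) ∘ₗ (LinearMap.mulRight ℚ c).rangeRestrict := by
    refine LinearMap.ext fun x => rfl
  have h2 : (LinearMap.mulRight ℚ c).rangeRestrict ∘ₗ (W.subtype ∘ₗ A) = m • A := by
    refine LinearMap.ext fun x => Subtype.ext ?_
    obtain ⟨y, hy⟩ := (A x).2
    rw [LinearMap.mulRight_apply] at hy
    simp only [LinearMap.comp_apply, LinearMap.smul_apply, Submodule.coe_smul,
      LinearMap.codRestrict_apply, LinearMap.rangeRestrict, LinearMap.mulRight_apply,
      Submodule.subtype_apply]
    rw [← hy, mul_assoc, hc, mul_smul_comm]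
  rw [twoSidedTrace_apply, h1, LinearMap.trace_comp_comm', h2, map_smul, smul_eq_mul]

/-- The product of the alternating sum over the complement of `T` and the sum over `T`. -/
def splitSymmetrizer (T : Finset (Fin n)) : GroupAlg n := altSum Tᶜ * symSum T

/-- The swaps (a j) with j outside T are conjugate to (a b) under (j b). This conjugation preserves
the trace, as the two signs produced by the alternating sum cancel; hence all swap terms of the
coset expansion agree. -/
theorem twoSidedTrace_altSum_insert (w : Equiv.Perm (Fin n)) {T : Finset (Fin n)} {a b : Fin n}
    (ha : a ∈ T) (hb : b ∉ T) :
    twoSidedTrace w (altSum (insert a Tᶜ) * symSum T) = twoSidedTrace w (splitSymmetrizer T) -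
      Tᶜ.card * twoSidedTrace w (altSum Tᶜ * el (Equiv.swap a b) * symSum T) := by
  have haT : a ∉ Tᶜ := by simpa using ha
  have hbT : b ∈ Tᶜ := by simpa using hb
  have hj : ∀ j ∈ Tᶜ, twoSidedTrace w (altSum Tᶜ * el (Equiv.swap a j) * symSum T) =
      twoSidedTrace w (altSum Tᶜ * el (Equiv.swap a b) * symSum T) := by
    intro j hj
    by_cases hjb : j = b
    · rw [hjb]
    have hs : Equiv.swap a j = Equiv.swap j b * Equiv.swap a b * Equiv.swap j b := by
      have h1 := swap_mul_swap_mul_swap_eq (a := b) (i := j) (j := a)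
        (fun h => haT (h ▸ hbT)) (fun h => haT (h ▸ hj))
      rw [Equiv.swap_comm b j, Equiv.swap_comm b a] at h1
      rw [h1, Equiv.swap_comm]
    have hcomm : el (Equiv.swap j b) * symSum T = symSum T * el (Equiv.swap j b) :=
      el_commute_twistedSum 1 disjoint_compl_left (swap_mem_permsOf hj hbT)
    calc twoSidedTrace w (altSum Tᶜ * el (Equiv.swap a j) * symSum T)
        = twoSidedTrace w ((altSum Tᶜ * el (Equiv.swap j b)) * el (Equiv.swap a b) *
            (el (Equiv.swap j b) * symSum T)) := by
          rw [hs, el_mul, el_mul]; simp only [mul_assoc]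
      _ = twoSidedTrace w (-(altSum Tᶜ * (el (Equiv.swap a b) * symSum T) *
            el (Equiv.swap j b))) := by
          rw [hcomm, altSum_mul_swap hj hbT hjb]
          simp only [mul_assoc, neg_mul]
      _ = twoSidedTrace w (-((el (Equiv.swap j b) * altSum Tᶜ) *
            (el (Equiv.swap a b) * symSum T))) := by
          rw [map_neg, twoSidedTrace_mul_comm, ← map_neg]; simp only [mul_assoc]
      _ = _ := by
          rw [swap_mul_altSum hj hbT hjb, neg_mul, neg_neg, mul_assoc]
  have hexp : altSum (insert a Tᶜ) = altSum Tᶜ + ∑ j ∈ Tᶜ, signHom n (Equiv.swap a j) •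
      (altSum Tᶜ * el (Equiv.swap a j)) := twistedSum_insert_right (signHom n) haT
  rw [hexp, add_mul, Finset.sum_mul, map_add, map_sum, ← splitSymmetrizer, sub_eq_add_neg,
    ← nsmul_eq_mul, ← Finset.sum_const, ← Finset.sum_neg_distrib]
  congr 1
  refine Finset.sum_congr rfl fun j hjT => ?_
  rw [signHom_swap (ne_of_mem_of_not_mem hjT haT).symm, smul_mul_assoc, map_smul, hj j hjT, neg_one_smul]

/-- The same argument with conjugation inside T, where the symmetric sum produces no signs. The
mixed trace is the one in `twoSidedTrace_altSum_insert`, so that it can be eliminated. -/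
theorem twoSidedTrace_symSum_insert (w : Equiv.Perm (Fin n)) {T : Finset (Fin n)} {a b : Fin n}
    (ha : a ∈ T) (hb : b ∉ T) :
    twoSidedTrace w (altSum Tᶜ * symSum (insert b T)) = twoSidedTrace w (splitSymmetrizer T) +
      T.card * twoSidedTrace w (altSum Tᶜ * el (Equiv.swap a b) * symSum T) := by
  have hbT : b ∈ Tᶜ := by simpa using hb
  have hi : ∀ i ∈ T, twoSidedTrace w (altSum Tᶜ * el (Equiv.swap b i) * symSum T) =
      twoSidedTrace w (altSum Tᶜ * el (Equiv.swap a b) * symSum T) := by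
    intro i hi
    by_cases hia : i = a
    · rw [hia, Equiv.swap_comm]
    have hs : Equiv.swap b i = Equiv.swap i a * Equiv.swap a b * Equiv.swap i a := by
      have h1 := swap_mul_swap_mul_swap_eq (a := a) (i := i) (j := b)
        (fun h => hb (h ▸ ha)) (fun h => hb (h ▸ hi))
      rw [Equiv.swap_comm a i] at h1
      rw [h1, Equiv.swap_comm]
    have hcomm : el (Equiv.swap i a) * altSum Tᶜ = altSum Tᶜ * el (Equiv.swap i a) :=
      el_commute_twistedSum (signHom n) disjoint_compl_right (swap_mem_permsOf hi ha)
    calc twoSidedTrace w (altSum Tᶜ * el (Equiv.swap b i) * symSum T)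
        = twoSidedTrace w ((altSum Tᶜ * el (Equiv.swap i a)) * el (Equiv.swap a b) *
            (el (Equiv.swap i a) * symSum T)) := by
          rw [hs, el_mul, el_mul]; simp only [mul_assoc]
      _ = twoSidedTrace w (el (Equiv.swap i a) *
            (altSum Tᶜ * el (Equiv.swap a b) * symSum T)) := by
          rw [swap_mul_symSum hi ha, ← hcomm]; simp only [mul_assoc]
      _ = twoSidedTrace w (altSum Tᶜ * el (Equiv.swap a b) *
            (symSum T * el (Equiv.swap i a))) := by
          rw [twoSidedTrace_mul_comm]; simp only [mul_assoc]
      _ = _ := by rw [symSum_mul_swap hi ha]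
  have hexp : symSum (insert b T) = symSum T + ∑ i ∈ T, el (Equiv.swap b i) * symSum T := by
    rw [symSum, twistedSum_insert_left 1 hb]
    simp only [MonoidHom.one_apply, one_smul, symSum]
  rw [hexp, mul_add, Finset.mul_sum, map_add, map_sum, ← splitSymmetrizer,
    ← nsmul_eq_mul, ← Finset.sum_const]
  congr 1
  refine Finset.sum_congr rfl fun i hiT => ?_
  rw [← mul_assoc, hi i hiT]

theorem restrictPerm_mem_permsOf {w : Equiv.Perm (Fin n)} {S : Finset (Fin n)}
    (h : Stable w S) : restrictPerm w S ∈ permsOf S :=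
  mem_permsOf.2 fun x hx => by rw [restrictPerm_apply h, if_neg hx]

theorem Stable.compl {w : Equiv.Perm (Fin n)} {S : Finset (Fin n)} (h : Stable w S) :
    Stable w Sᶜ := fun x => by rw [Finset.mem_compl, Finset.mem_compl, h]

/-- A permutation factors into permutations of the complement of T and of T only if these sets are
stable, and then the factors are its restrictions. -/
theorem coeff_splitSymmetrizer (T : Finset (Fin n)) (x : Equiv.Perm (Fin n)) :
    (splitSymmetrizer T).coeff x = signWeight x Tᶜ := by
  classical
  have h1 : splitSymmetrizer T = ∑ q ∈ permsOf Tᶜ ×ˢ permsOf T,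
      MonoidAlgebra.single (q.1 * q.2) (signQ q.1) := by
    rw [splitSymmetrizer, altSum, symSum, twistedSum, twistedSum, Finset.sum_mul_sum,
      ← Finset.sum_product']
    refine Finset.sum_congr rfl fun q _ => ?_
    simp [el, signHom_apply]
  have h2 : ∀ q ∈ permsOf Tᶜ ×ˢ permsOf T, q.1 * q.2 = x →
      Stable x Tᶜ ∧ q = (restrictPerm x Tᶜ, restrictPerm x T) := by
    rintro ⟨q, p⟩ hq rfl
    rw [Finset.mem_product] at hq
    have hq1 := mem_permsOf.1 hq.1
    have hq2 := mem_permsOf.1 hq.2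
    have hst : Stable (q * p) Tᶜ := fun x => by
      rw [Equiv.Perm.mul_apply, mem_iff_of_mem_permsOf hq.1, Finset.mem_compl, Finset.mem_compl,
        mem_iff_of_mem_permsOf hq.2]
    have hst' : Stable (q * p) T := by simpa using hst.compl
    refine ⟨hst, Prod.ext (Equiv.ext fun y => ?_) (Equiv.ext fun y => ?_)⟩
    · rw [restrictPerm_apply hst]
      split_ifs with hy
      · rw [Equiv.Perm.mul_apply, hq2 y (by simpa using hy)]
      · exact hq1 y hy
    · rw [restrictPerm_apply hst']
      split_ifs with hy
      · rw [Equiv.Perm.mul_apply, hq1]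
        simpa [mem_iff_of_mem_permsOf hq.2] using hy
      · exact hq2 y hy
  rw [h1, MonoidAlgebra.coeff_sum, Finsupp.finsetSum_apply]
  simp only [MonoidAlgebra.coeff_single, Finsupp.single_apply]
  by_cases hx : Stable x Tᶜ
  · have hx' : Stable x T := by simpa using hx.compl
    have hprod : restrictPerm x Tᶜ * restrictPerm x T = x := by
      rw [← restrictPerm_union hx hx' disjoint_compl_left]
      rw [Finset.union_comm, Finset.union_compl, restrictPerm_univ]
    rw [Finset.sum_eq_single (restrictPerm x Tᶜ, restrictPerm x T), if_pos hprod, signWeight,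
      if_pos hx]
    · intro q hq hne
      rw [if_neg fun h => hne (h2 q hq h).2]
    · intro h
      exact absurd (Finset.mem_product.2 ⟨restrictPerm_mem_permsOf hx,
        restrictPerm_mem_permsOf hx'⟩) h
  · rw [signWeight, if_neg hx]
    exact Finset.sum_eq_zero fun q hq => if_neg fun h => hx (h2 q hq h).1

theorem signWeight_conj (g w : Equiv.Perm (Fin n)) {S S' : Finset (Fin n)}
    (h : ∀ x, g x ∈ S' ↔ x ∈ S) : signWeight (g⁻¹ * w * g) S = signWeight w S' := by
  have hg : ∀ x, g (g⁻¹ x) = x := Equiv.apply_symm_apply g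
  have h' : ∀ x, g⁻¹ x ∈ S ↔ x ∈ S' := fun x => by rw [← h, hg]
  have hst : Stable (g⁻¹ * w * g) S ↔ Stable w S' := by
    refine ⟨fun hs x => ?_, fun hs x => ?_⟩
    · have := hs (g⁻¹ x)
      rwa [Equiv.Perm.mul_apply, hg, Equiv.Perm.mul_apply, h', h'] at this
    · rw [Equiv.Perm.mul_apply, Equiv.Perm.mul_apply, h', hs, h]
  by_cases hs : Stable w S'
  · rw [signWeight, signWeight, if_pos hs, if_pos (hst.2 hs)]
    have : restrictPerm (g⁻¹ * w * g) S = g⁻¹ * restrictPerm w S' * g := by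
      refine Equiv.ext fun x => ?_
      rw [restrictPerm_apply (hst.2 hs), Equiv.Perm.mul_apply, Equiv.Perm.mul_apply,
        Equiv.Perm.mul_apply, Equiv.Perm.mul_apply, restrictPerm_apply hs]
      simp only [h]
      split_ifs
      · rfl
      · exact (Equiv.symm_apply_apply g x).symm
    rw [this, signQ_mul, signQ_mul, signQ_inv, mul_comm (signQ g), mul_assoc, signQ_mul_self,
      mul_one]
  · rw [signWeight, signWeight, if_neg hs, if_neg fun h => hs (hst.1 h)]

theorem signWeight_inv (w : Equiv.Perm (Fin n)) (S : Finset (Fin n)) :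
    signWeight w⁻¹ S = signWeight w S := by
  have hw : ∀ x, w (w⁻¹ x) = x := Equiv.apply_symm_apply w
  have hw' : ∀ x, w⁻¹ (w x) = x := Equiv.symm_apply_apply w
  have hst : Stable w⁻¹ S ↔ Stable w S :=
    ⟨fun h x => by rw [← h, hw'], fun h x => by rw [← h, hw]⟩
  by_cases hs : Stable w S
  · have : restrictPerm w⁻¹ S = (restrictPerm w S)⁻¹ := by
      rw [eq_inv_iff_mul_eq_one]
      refine Equiv.ext fun x => ?_
      rw [Equiv.Perm.mul_apply, restrictPerm_apply hs, restrictPerm_apply (hst.2 hs)]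
      by_cases hx : x ∈ S
      · simp [hx, hs x, hw']
      · simp [hx]
    rw [signWeight, signWeight, if_pos hs, if_pos (hst.2 hs), this, signQ_inv]
  · rw [signWeight, signWeight, if_neg hs, if_neg fun h => hs (hst.1 h)]

open Classical in
theorem sum_perm_image (S : Finset (Fin n)) (F : Finset (Fin n) → ℚ) :
    ∑ g : Equiv.Perm (Fin n), F (S.map g.toEmbedding) =
      (S.card.factorial * Sᶜ.card.factorial : ℚ) *
        ∑ S' ∈ Finset.univ.powersetCard S.card, F S' := by
  let f₀ : Fin n → ℕ := fun x => if x ∈ S then 1 else 0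
  have hf₀ : fiber f₀ 1 = S := by
    ext x; simp [mem_fiber, f₀]
  have key : ∀ F : Finset (Fin n) → ℚ, ∑ g : Equiv.Perm (Fin n), F (S.map g.toEmbedding) =
      Nat.card (fiberSubgroup f₀) * ∑ S' ∈ Finset.univ.powersetCard S.card, F S' := by
    intro F
    have h1 : ∀ g : Equiv.Perm (Fin n), S.map g.toEmbedding = fiber (fun x => f₀ (g⁻¹ x)) 1 := by
      intro g
      ext x
      rw [mem_fiber, Finset.mem_map_equiv]
      change g⁻¹ x ∈ S ↔ _
      simp [f₀]
    simp only [h1]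
    rw [sum_comp_perm f₀ fun f => F (fiber f 1)]
    congr 1
    refine Finset.sum_bij' (fun f _ => fiber f 1) (fun S' _ x => if x ∈ S' then 1 else 0)
      ?_ ?_ ?_ ?_ ?_
    · intro f hf
      simp only [Finset.mem_image, Finset.mem_univ, true_and, mem_image_comp_perm] at hf
      rw [Finset.mem_powersetCard, hf, hf₀]
      exact ⟨Finset.subset_univ _, rfl⟩
    · intro S' hS'
      have hc := (Finset.mem_powersetCard.1 hS').2
      simp only [Finset.mem_image, Finset.mem_univ, true_and, mem_image_comp_perm]
      have h2 : ∀ (S : Finset (Fin n)) i, fiber (fun x => if x ∈ S then 1 else 0) i =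
          if i = 1 then S else if i = 0 then Sᶜ else ∅ := by
        intro S i
        ext x
        rw [mem_fiber]
        rcases i with _ | _ | i <;> by_cases hx : x ∈ S <;> simp [hx]
      intro i
      rw [h2, h2]
      split_ifs
      · exact hc
      · rw [Finset.card_compl, Finset.card_compl, hc]
      · rfl
    · intro f hf
      simp only [Finset.mem_image, Finset.mem_univ, true_and] at hf
      obtain ⟨g, rfl⟩ := hf
      ext x
      simp [mem_fiber, f₀]
    · intro S' _
      ext x; simp [mem_fiber]
    · intro f _; rfl
  rw [key F]
  congr 1
  -- The order of the stabilizer is found by counting: F = 1 gives n! on the left and a binomial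
  -- coefficient on the right.
  have h1 := key fun _ => 1
  simp only [Finset.sum_const, Finset.card_univ, Fintype.card_perm, Fintype.card_fin,
    Finset.card_powersetCard, nsmul_eq_mul, mul_one] at h1
  have h2 := Nat.choose_mul_factorial_mul_factorial (n := n) (k := S.card)
    (by simpa using Finset.card_le_univ S)
  have h3 : ((n.choose S.card : ℕ) : ℚ) ≠ 0 := Nat.cast_ne_zero.2
    (Nat.choose_pos (by simpa using Finset.card_le_univ S)).ne'
  rw [← h2] at h1
  rw [Finset.card_compl, Fintype.card_fin]
  push_cast at h1
  refine mul_right_cancel₀ h3 ?_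
  rw [← h1]; ring

/-- The trace of the sign-trivial symmetrizer is the induced character. -/
theorem twoSidedTrace_splitSymmetrizer (w : Equiv.Perm (Fin n)) (T : Finset (Fin n)) :
    twoSidedTrace w (splitSymmetrizer T) = (Tᶜ.card.factorial * T.card.factorial : ℚ) *
      weightSum (signWeight w) (stableWeight w) [Tᶜ.card] Finset.univ := by
  rw [twoSidedTrace_eq_sum]
  have h1 : ∀ g : Equiv.Perm (Fin n), (splitSymmetrizer T).coeff (g⁻¹ * w⁻¹ * g) =
      signWeight w (Tᶜ.map g.toEmbedding) := fun g => by
    rw [coeff_splitSymmetrizer, signWeight_conj g w⁻¹ (S' := Tᶜ.map g.toEmbedding),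
      signWeight_inv]
    intro x
    rw [Finset.mem_map_equiv, Equiv.symm_apply_apply]
  simp only [h1]
  rw [sum_perm_image Tᶜ, compl_compl, weightSum]
  congr 1
  refine Finset.sum_congr rfl fun S _ => ?_
  rw [weightSum]
  by_cases hS : Stable w S
  · rw [stableWeight, if_pos ((stable_univ w).sdiff hS), mul_one]
  · rw [signWeight, if_neg hS, zero_mul]

end Traces

/-! ### Characters of hook shapes -/

section HookCharacters

variable {n k : ℕ}

theorem rowList_hook (hk : 1 ≤ k) (hkn : k ≤ n) :
    rowList (hook n k hk hkn) = k :: List.replicate (n - k) 1 := by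
  change (k ::ₘ Multiset.replicate (n - k) 1).sort (· ≥ ·) = _
  rw [Multiset.sort_cons]
  · congr 1
    rw [List.eq_replicate_iff]
    refine ⟨by simp, fun b hb => ?_⟩
    exact Multiset.eq_of_mem_replicate ((Multiset.mem_sort (r := (· ≥ ·))).1 hb)
  · intro b hb
    rw [Multiset.eq_of_mem_replicate hb]
    exact hk

theorem sizeUpTo_hook (hk : 1 ≤ k) (hkn : k ≤ n) (j : ℕ) :
    (comp (hook n k hk hkn)).sizeUpTo j = if j = 0 then 0 else k + min (j - 1) (n - k) := by
  change ((rowList (hook n k hk hkn)).take j).sum = _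
  rw [rowList_hook]
  cases j with
  | zero => simp
  | succ j => simp [List.take_replicate]

theorem rowOf_hook (hk : 1 ≤ k) (hkn : k ≤ n) (x : Fin n) :
    rowOf (hook n k hk hkn) x = if (x : ℕ) < k then 0 else x - k + 1 := by
  have h1 := (comp (hook n k hk hkn)).sizeUpTo_index_le x
  have h2 := (comp (hook n k hk hkn)).lt_sizeUpTo_index_succ x
  rw [sizeUpTo_hook] at h1 h2
  rw [Fin.val_succ, if_neg (Nat.succ_ne_zero _)] at h2
  change (((comp (hook n k hk hkn)).index x : Fin _) : ℕ) = _
  split_ifs at h1 ⊢ <;> omega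

theorem colOf_hook (hk : 1 ≤ k) (hkn : k ≤ n) (x : Fin n) :
    colOf (hook n k hk hkn) x = if (x : ℕ) < k then (x : ℕ) else 0 := by
  have h := rowOf_hook hk hkn x
  rw [rowOf] at h
  rw [colOf, Composition.coe_invEmbedding, sizeUpTo_hook, h]
  have := x.2
  by_cases hx : (x : ℕ) < k
  · simp [hx]
  · simp only [hx, if_false, Nat.succ_ne_zero]
    omega

/-- The boxes of the first row of a hook. -/
def armSet (n k : ℕ) : Finset (Fin n) := Finset.univ.filter fun x => (x : ℕ) < k

theorem mem_armSet {x : Fin n} : x ∈ armSet n k ↔ (x : ℕ) < k := by simp [armSet]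

theorem card_armSet (hkn : k ≤ n) : (armSet n k).card = k := by
  rw [armSet, Fin.card_filter_val_lt, min_eq_right hkn]

theorem mem_youngSubgroup_hook (hk : 1 ≤ k) (hkn : k ≤ n) (p : Equiv.Perm (Fin n)) :
    p ∈ youngSubgroup (hook n k hk hkn) ↔ p ∈ permsOf (armSet n k) := by
  change (∀ i, rowOf (hook n k hk hkn) (p i) = rowOf (hook n k hk hkn) i) ↔ _
  simp only [rowOf_hook]
  refine ⟨fun h => mem_permsOf.2 fun x hx => ?_, fun h x => ?_⟩
  · rw [mem_armSet] at hx
    have := h x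
    refine Fin.ext ?_
    split_ifs at this; omega
  · by_cases hx : x ∈ armSet n k
    · have := (mem_iff_of_mem_permsOf h x).2 hx
      rw [mem_armSet] at hx this
      rw [if_pos hx, if_pos this]
    · rw [mem_permsOf.1 h x hx]

/-- All columns but the first are single boxes; the first consists of the corner `a` and the leg. -/
theorem mem_columnSubgroup_hook (hk : 1 ≤ k) (hkn : k ≤ n) {a : Fin n} (ha : (a : ℕ) = 0)
    (p : Equiv.Perm (Fin n)) : p ∈ columnSubgroup (hook n k hk hkn) ↔
      p ∈ permsOf (insert a (armSet n k)ᶜ) := by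
  have hmem : ∀ x : Fin n, x ∈ insert a (armSet n k)ᶜ ↔ (x : ℕ) = 0 ∨ k ≤ x := fun x => by
    rw [Finset.mem_insert, Finset.mem_compl, mem_armSet, Fin.ext_iff, ha, not_lt]
  change (∀ i, colOf (hook n k hk hkn) (p i) = colOf (hook n k hk hkn) i) ↔ _
  simp only [colOf_hook]
  refine ⟨fun h => mem_permsOf.2 fun x hx => ?_, fun h x => ?_⟩
  · rw [hmem] at hx
    have := h x
    refine Fin.ext ?_
    split_ifs at this <;> omega
  · by_cases hx : x ∈ insert a (armSet n k)ᶜ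
    · have := (mem_iff_of_mem_permsOf h x).2 hx
      rw [hmem] at hx this
      split_ifs <;> omega
    · rw [mem_permsOf.1 h x hx]

theorem youngSymmetrizer_hook (hk : 1 ≤ k) (hkn : k ≤ n) {a : Fin n} (ha : (a : ℕ) = 0) :
    youngSymmetrizer (hook n k hk hkn) =
      altSum (insert a (armSet n k)ᶜ) * symSum (armSet n k) := by
  classical
  rw [youngSymmetrizer]
  congr 1
  · rw [columnAntisymmetrizer, altSum, twistedSum, ← Finset.sum_filter]
    refine Finset.sum_congr ?_ fun p _ => ?_
    · ext p
      simp [mem_columnSubgroup_hook hk hkn ha]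
    · rw [signHom_apply, el, MonoidAlgebra.smul_single, smul_eq_mul, mul_one]; rfl
  · rw [rowSymmetrizer, symSum, twistedSum, ← Finset.sum_filter]
    refine Finset.sum_congr ?_ fun p _ => ?_
    · ext p
      simp [mem_youngSubgroup_hook hk hkn]
    · rw [MonoidHom.one_apply, one_smul]; rfl

/-- The factor is the product of the hook lengths: n for the corner, (k-1)! for the arm, (n-k)! for
the leg. It is the scalar of `hookSymmetrizer_mul_self`. -/
theorem irrChar_hook (hk : 1 ≤ k) (hkn : k ≤ n) {a : Fin n} (ha : (a : ℕ) = 0)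
    (w : Equiv.Perm (Fin n)) :
    ((n * (k - 1).factorial * (n - k).factorial : ℕ) : ℚ) * irrChar (hook n k hk hkn) w =
      twoSidedTrace w (altSum (insert a (armSet n k)ᶜ) * symSum (armSet n k)) := by
  rw [← youngSymmetrizer_hook hk hkn ha]
  refine trace_restrict_range_mulRight ?_ w _
  have haX : a ∈ armSet n k := mem_armSet.2 (by omega)
  have h := hookSymmetrizer_mul_self (X := (armSet n k).erase a) (Y := (armSet n k)ᶜ) (a := a)
    (Finset.notMem_erase _ _) (by simpa using haX)
    (disjoint_compl_right.mono_left (Finset.erase_subset _ _))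
  rw [Finset.insert_erase haX, Finset.card_erase_of_mem haX, Finset.card_compl,
    card_armSet hkn, Fintype.card_fin] at h
  rw [youngSymmetrizer_hook hk hkn ha, h]
  congr 4
  omega

/-- The character of a one-row shape. -/
theorem irrChar_row (hn : 1 ≤ n) (w : Equiv.Perm (Fin n)) :
    irrChar (hook n n hn le_rfl) w =
      weightSum (signWeight w) (stableWeight w) [] Finset.univ := by
  have h := irrChar_hook hn le_rfl (a := ⟨0, hn⟩) rfl w
  have h1 : armSet n n = Finset.univ := by
    ext x; simp [armSet]
  have h2 : (altSum (insert ⟨0, hn⟩ ∅ : Finset (Fin n))) = altSum ∅ := by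
    rw [altSum, twistedSum_insert_left (signHom n) (Finset.notMem_empty _), Finset.sum_empty,
      add_zero, altSum]
  have h3 := twoSidedTrace_splitSymmetrizer w Finset.univ
  rw [splitSymmetrizer] at h3
  rw [h1] at h
  rw [Finset.compl_univ] at h h3
  rw [h2, h3] at h
  rw [Finset.card_empty, weightSum_zero_cons (perm_weightInverse w), Finset.card_univ,
    Fintype.card_fin, Nat.sub_self, Nat.factorial_zero, mul_one,
    Nat.mul_factorial_pred (by omega), Nat.cast_one, one_mul] at h
  exact mul_left_cancel₀ (Nat.cast_ne_zero.2 (Nat.factorial_ne_zero n)) h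

/-- Pieri's rule for the characters of neighbouring hooks. -/
theorem irrChar_hook_add (hk : 1 ≤ k) (hkn : k + 1 ≤ n) (w : Equiv.Perm (Fin n)) :
    irrChar (hook n k hk (by omega)) w + irrChar (hook n (k + 1) (by omega) hkn) w =
      weightSum (signWeight w) (stableWeight w) [n - k] Finset.univ := by
  let a : Fin n := ⟨0, by omega⟩
  let b : Fin n := ⟨k, by omega⟩
  have ha : a ∈ armSet n k := mem_armSet.2 hk
  have hb : b ∉ armSet n k := fun h => lt_irrefl _ (mem_armSet.1 h)
  have hins : armSet n (k + 1) = insert b (armSet n k) := by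
    ext x
    rw [Finset.mem_insert, mem_armSet, mem_armSet, Fin.ext_iff]
    change _ ↔ (x : ℕ) = k ∨ _
    omega
  have h1 := irrChar_hook hk (by omega : k ≤ n) (a := a) rfl w
  have h2 := irrChar_hook (by omega : 1 ≤ k + 1) hkn (a := a) rfl w
  -- Conjugation by (a b) turns the column of the larger hook into the complement of the shorter
  -- arm, so both hooks are compared with the same split.
  have h3 : twoSidedTrace w (altSum (insert a (armSet n (k + 1))ᶜ) * symSum (armSet n (k + 1))) =
      twoSidedTrace w (altSum (armSet n k)ᶜ * symSum (insert b (armSet n k))) := by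
    have ha' : a ∈ insert b (armSet n k) := Finset.mem_insert_of_mem ha
    have hb' : b ∈ insert b (armSet n k) := Finset.mem_insert_self _ _
    have hab : a ≠ b := ne_of_mem_of_not_mem ha hb
    have hc : el (Equiv.swap a b) * altSum (armSet n k)ᶜ =
        altSum (insert a (insert b (armSet n k))ᶜ) * el (Equiv.swap a b) := by
      refine el_mul_twistedSum_conj (signHom n) fun x => ?_
      rw [Finset.mem_insert, Finset.mem_compl, Finset.mem_insert, Finset.mem_compl]
      by_cases hxa : x = a
      · subst hxa; simp [hab.symm, ha]
      by_cases hxb : x = b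
      · subst hxb; simp [hb]
      rw [Equiv.swap_apply_of_ne_of_ne hxa hxb]
      simp [hxa, hxb]
    rw [hins, ← swap_mul_symSum ha' hb', ← mul_assoc, ← hc, mul_assoc, twoSidedTrace_mul_comm,
      mul_assoc, symSum_mul_swap ha' hb', swap_mul_symSum ha' hb']
  rw [twoSidedTrace_altSum_insert w ha hb] at h1
  rw [h3, twoSidedTrace_symSum_insert w ha hb] at h2
  rw [twoSidedTrace_splitSymmetrizer, Finset.card_compl, Fintype.card_fin,
    card_armSet (by omega : k ≤ n)] at h1 h2
  set W := weightSum (signWeight w) (stableWeight w) [n - k] Finset.univ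
  set F := twoSidedTrace w (altSum (armSet n k)ᶜ * el (Equiv.swap a b) * symSum (armSet n k))
  clear_value W F
  obtain ⟨i, rfl⟩ := Nat.exists_eq_add_of_le' hk
  obtain ⟨j, rfl⟩ := Nat.exists_eq_add_of_le hkn
  have e1 : i + 1 + 1 + j - (i + 1) = j + 1 := by omega
  have e2 : i + 1 + 1 + j - (i + 1 + 1) = j := by omega
  rw [e1] at h1 h2
  rw [e2] at h2
  rw [Nat.add_sub_cancel] at h1 h2
  simp only [Nat.factorial_succ] at h1 h2
  push_cast at h1 h2
  have hi : (i.factorial : ℚ) ≠ 0 := Nat.cast_ne_zero.2 (Nat.factorial_ne_zero i)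
  have hj : (j.factorial : ℚ) ≠ 0 := Nat.cast_ne_zero.2 (Nat.factorial_ne_zero j)
  have hc : ((i : ℚ) + 1 + 1 + j) * ((i + 1) * i.factorial * ((j + 1) * j.factorial)) ≠ 0 := by
    positivity
  refine mul_left_cancel₀ hc ?_
  -- The mixed trace F enters with factor -(n-k) = -(j+1) in `h1` and k = i+1 in `h2`; these
  -- multipliers eliminate it.
  linear_combination ((i : ℚ) + 1) * h1 + ((j : ℚ) + 1) * h2

end HookCharacters

/-! ### Evaluation of hook characters at incomparability graphs -/

section HookEvaluation

variable {P : Type*} [PartialOrder P] [Fintype P] [DecidableEq P] {n : ℕ}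

/-- The equation Y(D) = X says that weight sums of permutations and of the poset agree on all
partitions; `weightSum_transfer` extends this to one block with a remainder. -/
theorem sum_coeff_weightSum (hP : Fintype.card P = n) {D : GroupAlg n}
    (hD : symmGen D = chromSymm n (incGraph P)) {i : ℕ} (hi : i ≤ n) :
    ∑ w, D.coeff w * weightSum (signWeight w) (stableWeight w) [i] Finset.univ =
      ((listPairs (Finset.univ : Finset P) i).ncard : ℚ) := by
  rw [symmGen_eq_chromSymm_iff] at hD
  have key := weightSum_transfer (ι := Equiv.Perm (Fin n)) (V := Fin n) (W := P)
    (Fintype.card_fin n) hP D.coeff (p := signWeight) (q := stableWeight)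
    (p' := increasingWeight) (q' := descentFreeWeight) perm_weightInverse poset_weightInverse
    (fun μ => by
      rw [← numColorings_incGraph hP, ← hD μ, evalAlg]
      simp only [epsilonChar_eq])
  have h1 : ((listPairs (Finset.univ : Finset P) i).ncard : ℚ) =
      weightSum increasingWeight descentFreeWeight [i] (Finset.univ : Finset P) := by
    rw [ncard_listPairs, weightSum]; rfl
  rw [h1]
  -- The transfer requires positive blocks, so i = 0 is read as the empty list of blocks.
  rcases Nat.eq_zero_or_pos i with rfl | hi0
  · rw [weightSum_zero_cons poset_weightInverse, ← key [] (by simp) (by simp)]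
    simp only [weightSum_zero_cons (perm_weightInverse _)]
  · exact key [i] (by simpa using hi0) (by simpa using hi)

theorem evalAlg_add (θ θ' : Equiv.Perm (Fin n) → ℚ) (D : GroupAlg n) :
    evalAlg (fun w => θ w + θ' w) D = evalAlg θ D + evalAlg θ' D := by
  simp [evalAlg, mul_add, Finset.sum_add_distrib]

/-- The value of a hook character at an incomparability graph is the number of standard fillings
of the hook. -/
theorem evalAlg_irrChar_hook (hP : Fintype.card P = n) {D : GroupAlg n}
    (hD : symmGen D = chromSymm n (incGraph P)) {k : ℕ} (hk : 1 ≤ k) (hkn : k ≤ n) :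
    evalAlg (irrChar (hook n k hk hkn)) D =
      ((hookPairs (Finset.univ : Finset P) (n - k)).ncard : ℚ) := by
  -- Induction on the leg: characters and hook counts satisfy the same two-term recursion and agree
  -- for the one-row shape.
  induction h : n - k generalizing k with
  | zero =>
    obtain rfl : k = n := by omega
    have hne : (Finset.univ : Finset P).Nonempty := by
      rw [← Finset.card_pos, Finset.card_univ, hP]; exact hk
    have h0 := sum_coeff_weightSum hP hD (Nat.zero_le k)
    simp only [weightSum_zero_cons (perm_weightInverse _)] at h0
    rw [← ncard_listPairs_zero hne, ← h0, evalAlg]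
    simp only [irrChar_row]
  | succ i ih =>
    have h1 := ih (k := k + 1) (by omega) (by omega) (by omega)
    have h2 := sum_coeff_weightSum hP hD (i := i + 1) (by omega)
    rw [ncard_listPairs_succ, ← h] at h2
    simp only [← irrChar_hook_add hk (by omega : k + 1 ≤ n)] at h2
    change evalAlg (fun w => irrChar (hook n k hk (by omega)) w +
      irrChar (hook n (k + 1) (by omega) (by omega)) w) D = _ at h2
    rw [evalAlg_add, h1, h] at h2
    push_cast at h2
    exact add_right_cancel h2

end HookEvaluation

/-! ### Fillings of hooks with a marked entry -/

section MarkedLists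

variable {P : Type*} [PartialOrder P] [DecidableEq P]

/-- Hook fillings with a marked entry of the first row outside the corner. -/
def armMarked (T : Finset P) (i : ℕ) : Set (List P × P × List P × List P) :=
  {z | z.1 ≠ [] ∧ (z.1 ++ z.2.1 :: z.2.2.1, z.2.2.2) ∈ hookPairs T i}

/-- Hook fillings with a marked entry of the first row that is incomparable to an entry in an
earlier column. -/
def incomparablyMarked (T : Finset P) (i : ℕ) : Set (List P × P × List P × List P) :=
  {z | z ∈ armMarked T i ∧ ∃ y ∈ z.1 ++ z.2.2.2, IncompRel (· ≤ ·) y z.2.1}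

/-- Hook fillings with a marked entry of the leg. -/
def legMarked (T : Finset P) (i : ℕ) : Set (List P × List P × P × List P) :=
  {z | (z.1, z.2.1 ++ z.2.2.1 :: z.2.2.2) ∈ hookPairs T i}

omit [PartialOrder P] [DecidableEq P] in
theorem exists_split {l : List P} {j : ℕ} (hj : j < l.length) :
    ∃ l₁ x l₂, l = l₁ ++ x :: l₂ ∧ l₁.length = j :=
  ⟨l.take j, l[j], l.drop (j + 1), by
    rw [← List.drop_eq_getElem_cons hj, List.take_append_drop], by simp; omega⟩

theorem card_eq_of_mem_listPairs {T : Finset P} {i : ℕ} {l c : List P}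
    (h : (l, c) ∈ listPairs T i) : l.length + i = T.card := by
  obtain ⟨h1, h2, h3, -⟩ := h
  have := List.toFinset_card_of_nodup h1
  rw [h2, List.length_append] at this
  simp only at h3 this
  omega

theorem ncard_armMarked [Finite P] {T : Finset P} {i k : ℕ} (hk : T.card = k + 1 + i) :
    (armMarked T i).ncard = k * (hookPairs T i).ncard := by
  have h : (armMarked T i).ncard = (Set.Ioo 0 (k + 1) ×ˢ hookPairs T i).ncard := by
    refine Set.ncard_congr (fun z _ => (z.1.length, (z.1 ++ z.2.1 :: z.2.2.1, z.2.2.2))) ?_ ?_ ?_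
    · rintro ⟨l₁, x, l₂, c⟩ ⟨h1, h2⟩
      have := card_eq_of_mem_listPairs h2.1
      have h3 := List.length_pos_iff.2 h1
      simp only [List.length_append, List.length_cons] at this h3
      refine ⟨⟨h3, ?_⟩, h2⟩
      simp only
      omega
    · rintro ⟨l₁, x, l₂, c⟩ ⟨l₁', x', l₂', c'⟩ _ _ h
      simp only [Prod.mk.injEq] at h
      obtain ⟨rfl, h2⟩ := List.append_inj h.2.1 h.1
      simp only [List.cons.injEq] at h2
      obtain ⟨rfl, rfl⟩ := h2
      obtain rfl := h.2.2
      rfl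
    · rintro ⟨j, l, c⟩ ⟨⟨h1, h2⟩, h3⟩
      simp only at h1 h2 h3
      have := card_eq_of_mem_listPairs h3.1
      obtain ⟨l₁, x, l₂, rfl, rfl⟩ := exists_split (l := l) (j := j) (by omega)
      exact ⟨(l₁, x, l₂, c), ⟨List.length_pos_iff.1 h1, h3⟩, rfl⟩
  rw [h, Set.ncard_prod]
  congr 1
  rw [← Finset.coe_Ioo, Set.ncard_coe_finset]
  simp

theorem ncard_legMarked [Finite P] (T : Finset P) (i : ℕ) :
    (legMarked T i).ncard = i * (hookPairs T i).ncard := by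
  have h : (legMarked T i).ncard = (Set.Iio i ×ˢ hookPairs T i).ncard := by
    refine Set.ncard_congr (fun z _ => (z.2.1.length, (z.1, z.2.1 ++ z.2.2.1 :: z.2.2.2))) ?_ ?_ ?_
    · rintro ⟨l, c₁, x, c₂⟩ h
      have := h.1.2.2.1
      simp only [List.length_append, List.length_cons] at this
      refine ⟨?_, h⟩
      simp only [Set.mem_Iio]
      omega
    · rintro ⟨l, c₁, x, c₂⟩ ⟨l', c₁', x', c₂'⟩ _ _ h
      simp only [Prod.mk.injEq] at h
      obtain ⟨rfl, h2⟩ := List.append_inj h.2.2 h.1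
      simp only [List.cons.injEq] at h2
      obtain ⟨rfl, rfl⟩ := h2
      obtain rfl := h.2.1
      rfl
    · rintro ⟨j, l, c⟩ ⟨h1, h3⟩
      simp only [Set.mem_Iio] at h1 h3
      have := h3.1.2.2.1
      simp only at this
      obtain ⟨c₁, x, c₂, rfl, rfl⟩ := exists_split (l := c) (j := j) (by omega)
      exact ⟨(l, c₁, x, c₂), h3, rfl⟩
  rw [h, Set.ncard_prod]
  congr 1
  rw [← Finset.coe_Iio, Set.ncard_coe_finset]
  simp

/-! ### Inserting an element into a chain -/

open Classical in
/-- The part of a list before the first entry that is not less than `x`. -/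
def before (x : P) (l : List P) : List P := l.takeWhile fun y => y < x

open Classical in
/-- The part of a list from the first entry on that is not less than `x`. -/
def after (x : P) (l : List P) : List P := l.dropWhile fun y => y < x

omit [DecidableEq P] in
theorem before_append_after (x : P) (l : List P) : before x l ++ after x l = l :=
  List.takeWhile_append_dropWhile

omit [DecidableEq P] in
theorem lt_of_mem_before {x y : P} {l : List P} (h : y ∈ before x l) : y < x := by
  simpa using List.mem_takeWhile_imp h

omit [DecidableEq P] in
theorem not_lt_of_mem_head_after {x y : P} {l : List P} (h : y ∈ (after x l).head?) :
    ¬ y < x := by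
  induction l with
  | nil => simp [after] at h
  | cons a l ih =>
    by_cases ha : a < x
    · exact ih (by simpa [after, ha] using h)
    · have : a = y := by simpa [after, ha] using h
      exact this ▸ ha

omit [DecidableEq P] in
-- The cut point of a list is determined by x; this makes moving x between row and leg reversible.
theorem before_append {x : P} {l₁ l₂ : List P} (h1 : ∀ y ∈ l₁, y < x)
    (h2 : ∀ y ∈ l₂.head?, ¬ y < x) : before x (l₁ ++ l₂) = l₁ ∧ after x (l₁ ++ l₂) = l₂ := by
  induction l₁ with
  | nil =>
    cases l₂ with
    | nil => simp [before, after]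
    | cons a l₂ =>
      have := h2 a (by simp)
      simp [before, after, this]
  | cons a l₁ ih =>
    have ha := h1 a (by simp)
    have := ih fun y hy => h1 y (by simp [hy])
    simpa [before, after, ha] using this

omit [DecidableEq P] in
/-- A chain remains a chain after inserting an element comparable to all its members. -/
theorem pairwise_insert {x : P} {c : List P} (hc : c.Pairwise (· < ·))
    (hx : ∀ y ∈ c, y < x ∨ x < y) : (before x c ++ x :: after x c).Pairwise (· < ·) := by
  induction c with
  | nil => simp [before, after]
  | cons a c ih =>
    rw [List.pairwise_cons] at hc
    by_cases ha : a < x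
    · have hb : before x (a :: c) = a :: before x c := by simp [before, ha]
      have ha' : after x (a :: c) = after x c := by simp [after, ha]
      rw [hb, ha', List.cons_append, List.pairwise_cons]
      refine ⟨fun y hy => ?_, ih hc.2 fun y hy => hx y (by simp [hy])⟩
      rw [List.mem_append, List.mem_cons] at hy
      have hmem : ∀ z, z ∈ before x c ∨ z ∈ after x c → z ∈ c := fun z hz => by
        rw [← before_append_after x c, List.mem_append]; exact hz
      rcases hy with hy | rfl | hy
      · exact hc.1 y (hmem y (Or.inl hy))
      · exact ha
      · exact hc.1 y (hmem y (Or.inr hy))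
    · have hb : before x (a :: c) = [] := by simp [before, ha]
      have ha' : after x (a :: c) = a :: c := by simp [after, ha]
      have hxa := (hx a (by simp)).resolve_left ha
      rw [hb, ha', List.nil_append, List.pairwise_cons, List.pairwise_cons]
      refine ⟨fun y hy => ?_, hc⟩
      rcases List.mem_cons.1 hy with rfl | hy
      · exact hxa
      · exact hxa.trans (hc.1 y hy)

omit [DecidableEq P] in
-- Read from right to left: an entry above x followed by x, or by an entry below x, would be a
-- descent.
theorem lt_of_descentFree {x : P} {l₁ l₂ : List P}
    (h : (l₁ ++ x :: l₂).IsChain fun a b => ¬ b < a) (hx : ∀ y ∈ l₁, y < x ∨ x < y) :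
    ∀ y ∈ l₁, y < x := by
  induction l₁ with
  | nil => simp
  | cons a l₁ ih =>
    have ih' := ih h.tail fun y hy => hx y (by simp [hy])
    intro y hy
    rcases List.mem_cons.1 hy with rfl | hy
    · refine (hx y (by simp)).resolve_right fun hxy => ?_
      cases l₁ with
      | nil => exact (List.isChain_cons_cons.1 h).1 hxy
      | cons z l₁ => exact (List.isChain_cons_cons.1 h).1 ((ih' z (by simp)).trans hxy)
    · exact ih' y hy

/-- Fillings with an admissible marked entry in the first row correspond to fillings of the
neighbouring hook with a marked entry in the leg. -/
theorem ncard_legMarked_eq (T : Finset P) (i : ℕ) :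
    (armMarked T i \ incomparablyMarked T i).ncard = (legMarked T (i + 1)).ncard := by
  -- The columns before x contain exactly `l₁` and the leg `c`, so x is comparable to all of these;
  -- the entry after x is not below it, as the row has no descent.
  have hgood : ∀ l₁ x l₂ c, (l₁, x, l₂, c) ∈ armMarked T i \ incomparablyMarked T i →
      (∀ y ∈ l₁, y < x) ∧ (∀ y ∈ l₂.head?, ¬ y < x) ∧ ∀ y ∈ c, y < x ∨ x < y := by
    rintro l₁ x l₂ c ⟨h, hn⟩
    obtain ⟨-, ⟨h1, h2, h3, h4, h5⟩, -⟩ := id h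
    have hcomp : ∀ y ∈ l₁ ++ c, y < x ∨ x < y := by
      intro y hy
      have hyx : y ≠ x := by
        rintro rfl
        have hp : (l₁ ++ y :: l₂ ++ c).Perm (y :: (l₁ ++ c ++ l₂)) := by
          rw [List.perm_iff_count]
          intro b
          simp only [List.count_append, List.count_cons]
          omega
        have := hp.nodup_iff.1 h1
        rw [List.nodup_cons, List.mem_append] at this
        exact this.1 (Or.inl hy)
      by_contra hcon
      rw [not_or] at hcon
      refine hn ⟨h, y, hy, fun hle => hcon.1 (lt_of_le_of_ne hle hyx),
        fun hle => hcon.2 (lt_of_le_of_ne hle hyx.symm)⟩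
    refine ⟨lt_of_descentFree h4 fun y hy => hcomp y (by simp [hy]), fun y hy => ?_,
      fun y hy => hcomp y (by simp [hy])⟩
    have h6 := (List.isChain_append.1 h4).2.1
    exact (List.isChain_cons.1 h6).1 y hy
  have hperm : ∀ (l₁ : List P) x l₂ c₁ c₂,
      (l₁ ++ x :: l₂ ++ (c₁ ++ c₂)).Perm (l₁ ++ l₂ ++ (c₁ ++ x :: c₂)) := by
    intro l₁ x l₂ c₁ c₂
    rw [List.perm_iff_count]
    intro b
    simp only [List.count_append, List.count_cons]
    omega
  -- The marked entry leaves the row and enters the leg at the only place where the leg stays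
  -- increasing.
  refine Set.ncard_congr (fun z _ => (z.1 ++ z.2.2.1, before z.2.1 z.2.2.2, z.2.1,
    after z.2.1 z.2.2.2)) ?_ ?_ ?_
  · rintro ⟨l₁, x, l₂, c⟩ h
    obtain ⟨g1, g2, g3⟩ := hgood _ _ _ _ h
    obtain ⟨⟨hl, ⟨h1, h2, h3, h4, h5⟩, a, l, h6, h7⟩, -⟩ := h
    simp only at h1 h2 h3 h4 h5 h6 h7 hl
    have hp := hperm l₁ x l₂ (before x c) (after x c)
    rw [before_append_after] at hp
    obtain ⟨b, l₁, rfl⟩ := List.exists_cons_of_ne_nil hl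
    rw [List.cons_append, List.cons.injEq] at h6
    obtain ⟨rfl, -⟩ := h6
    refine ⟨⟨hp.nodup_iff.1 h1, ?_, ?_, ?_, ?_⟩, b, l₁ ++ l₂, rfl, ?_⟩
    · rw [← h2]
      exact (List.toFinset_eq_of_perm _ _ hp).symm
    · rw [← h3]
      conv_rhs => rw [← before_append_after x c]
      simp only [List.length_append, List.length_cons]
      omega
    -- At the junction u, v left by x one has u < x, so a descent v < u would put v below x.
    · rw [List.isChain_append] at h4 ⊢
      refine ⟨h4.1, (List.isChain_cons.1 h4.2.1).2, fun u hu v hv hvu => ?_⟩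
      exact g2 v hv (hvu.trans (g1 u (List.mem_of_getLast? hu)))
    · rw [List.isChain_iff_pairwise] at h5 ⊢
      exact pairwise_insert h5 g3
    · rw [List.isChain_iff_pairwise] at h7 ⊢
      -- The corner precedes x in the row, so it is smaller than x and stays on top of the column.
      have hb := g1 b (by simp)
      have := pairwise_insert (x := x) h7 (by
        intro y hy
        rcases List.mem_cons.1 hy with rfl | hy
        · exact Or.inl hb
        · exact g3 y hy)
      have e1 : before x (b :: c) = b :: before x c := by simp [before, hb]
      have e2 : after x (b :: c) = after x c := by simp [after, hb]
      rwa [e1, e2] at this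
  · rintro ⟨l₁, x, l₂, c⟩ ⟨l₁', x', l₂', c'⟩ h h' he
    simp only [Prod.mk.injEq] at he
    obtain ⟨e1, e2, rfl, e3⟩ := he
    obtain ⟨g1, g2, -⟩ := hgood _ _ _ _ h
    obtain ⟨g1', g2', -⟩ := hgood _ _ _ _ h'
    have hc : c = c' := by rw [← before_append_after x c, e2, e3, before_append_after]
    have b1 := before_append g1 g2
    have b2 := before_append g1' g2'
    rw [e1] at b1
    rw [← b1.1, ← b1.2, b2.1, b2.2, hc]
  · rintro ⟨l, c₁, x, c₂⟩ ⟨⟨h1, h2, h3, h4, h5⟩, a, l', h6, h7⟩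
    simp only at h1 h2 h3 h4 h5 h6 h7
    have hpw := List.isChain_iff_pairwise.1 h7
    have hax : a < x := (List.pairwise_cons.1 hpw).1 x (by simp)
    have hcx : (∀ y ∈ c₁, y < x) ∧ ∀ y ∈ c₂, x < y := by
      have := (List.pairwise_cons.1 hpw).2
      rw [List.pairwise_append, List.pairwise_cons] at this
      exact ⟨fun y hy => this.2.2 y hy x (by simp), this.2.1.1⟩
    have hsub : (c₁ ++ c₂).Sublist (c₁ ++ x :: c₂) :=
      (List.sublist_cons_self x c₂).append_left c₁
    have hp := hperm (before x l) x (after x l) c₁ c₂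
    rw [before_append_after] at hp
    -- Conversely, x re-enters the row before its first entry that is not below x. The corner a is
    -- below x, so x does not become the corner.
    have hbl : before x l = a :: before x l' := by rw [h6]; simp [before, hax]
    have hmem : (before x l, x, after x l, c₁ ++ c₂) ∈ armMarked T i := by
      refine ⟨by simp [hbl], ⟨hp.nodup_iff.2 h1, ?_, ?_, ?_, ?_⟩, a,
        before x l' ++ x :: after x l, by simp [hbl], ?_⟩
      · rw [← h2]
        exact List.toFinset_eq_of_perm _ _ hp
      · simp only [List.length_append, List.length_cons] at h3 ⊢
        omega
      · rw [List.isChain_append, List.isChain_cons]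
        have h4' := h4
        rw [← before_append_after x l, List.isChain_append] at h4'
        refine ⟨h4'.1, ⟨fun y hy => not_lt_of_mem_head_after hy, h4'.2.1⟩, fun u hu v hv => ?_⟩
        have hv' : v = x := by simpa using hv.symm
        rw [hv']
        exact (lt_of_mem_before (List.mem_of_getLast? hu)).not_gt
      · rw [List.isChain_iff_pairwise] at h5 ⊢
        exact h5.sublist hsub
      · rw [List.isChain_iff_pairwise]
        exact hpw.sublist (hsub.cons_cons a)
    refine ⟨_, ⟨hmem, ?_⟩, ?_⟩
    · rintro ⟨-, y, hy, hinc⟩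
      simp only [List.mem_append] at hy
      rcases hy with hy | hy | hy
      · exact hinc.1 (lt_of_mem_before hy).le
      · exact hinc.1 (hcx.1 y hy).le
      · exact hinc.2 (hcx.2 y hy).le
    · have b := before_append hcx.1 fun y hy =>
        (hcx.2 y (List.mem_of_head? hy)).not_gt
      simp only [b.1, b.2, before_append_after]

theorem finite_armMarked [Finite P] (T : Finset P) (i : ℕ) : (armMarked T i).Finite := by
  refine Set.Finite.of_finite_image (f := fun z : List P × P × List P × List P =>
    (z.1.length, (z.1 ++ z.2.1 :: z.2.2.1, z.2.2.2))) ?_ ?_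
  · refine ((Set.finite_Iic T.card).prod (finite_hookPairs T i)).subset ?_
    rintro _ ⟨⟨l₁, x, l₂, c⟩, ⟨-, h⟩, rfl⟩
    have := card_eq_of_mem_listPairs h.1
    simp only [List.length_append, List.length_cons] at this
    refine ⟨?_, h⟩
    simp only [Set.mem_Iic]
    omega
  · rintro ⟨l₁, x, l₂, c⟩ _ ⟨l₁', x', l₂', c'⟩ _ h
    simp only [Prod.mk.injEq] at h
    obtain ⟨rfl, h2⟩ := List.append_inj h.2.1 h.1
    simp only [List.cons.injEq] at h2
    obtain ⟨rfl, rfl⟩ := h2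
    obtain rfl := h.2.2
    rfl

/-- All k markings of non-corner row entries are counted; those without an incomparable earlier
entry correspond to leg markings of the hook with a longer leg. -/
theorem ncard_incomparablyMarked [Finite P] {T : Finset P} {i k : ℕ} (hk : T.card = k + 1 + i) :
    k * (hookPairs T i).ncard =
      (incomparablyMarked T i).ncard + (i + 1) * (hookPairs T (i + 1)).ncard := by
  have hsub : incomparablyMarked T i ⊆ armMarked T i := fun _ h => h.1
  rw [← ncard_armMarked hk, ← ncard_legMarked, ← ncard_legMarked_eq, add_comm,
    Set.ncard_sdiff_add_ncard_of_subset hsub (finite_armMarked T i)]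

end MarkedLists

/-! ### Tableaux of hook shape -/

section HookTableaux

variable {n k : ℕ}

theorem mem_diagram_hook (hk : 1 ≤ k) (hkn : k ≤ n) {c : ℕ × ℕ} :
    c ∈ diagram (hook n k hk hkn) ↔ c.1 = 0 ∧ c.2 < k ∨ 0 < c.1 ∧ c.1 ≤ n - k ∧ c.2 = 0 := by
  have key : ∀ (w : List ℕ) (hw : w.SortedGE), w = k :: List.replicate (n - k) 1 →
      (c ∈ YoungDiagram.ofRowLens w hw ↔
        c.1 = 0 ∧ c.2 < k ∨ 0 < c.1 ∧ c.1 ≤ n - k ∧ c.2 = 0) := by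
    rintro w hw rfl
    rw [YoungDiagram.mem_ofRowLens]
    obtain ⟨i, j⟩ := c
    cases i with
    | zero => simp
    | succ i => simp
  exact key _ _ (rowList_hook hk hkn)

/-- The box of the first row of a hook in the given column. -/
def armBox (hk : 1 ≤ k) (hkn : k ≤ n) (j : Fin k) : Box (hook n k hk hkn) :=
  ⟨(0, j), (mem_diagram_hook hk hkn).2 (Or.inl ⟨rfl, j.2⟩)⟩

/-- The boxes of the first column of a hook below the first row. -/
def legBox (hk : 1 ≤ k) (hkn : k ≤ n) (i : Fin (n - k)) : Box (hook n k hk hkn) :=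
  ⟨(i + 1, 0), (mem_diagram_hook hk hkn).2
    (Or.inr ⟨Nat.succ_pos _, Nat.succ_le_of_lt i.2, rfl⟩)⟩

theorem box_cases {hk : 1 ≤ k} {hkn : k ≤ n} (b : Box (hook n k hk hkn)) :
    (∃ j, b = armBox hk hkn j) ∨ ∃ i, b = legBox hk hkn i := by
  obtain ⟨⟨i, j⟩, hb⟩ := b
  rcases (mem_diagram_hook hk hkn).1 hb with ⟨h1, h2⟩ | ⟨h1, h2, h3⟩
  · simp only at h1 h2
    subst h1
    exact Or.inl ⟨⟨j, h2⟩, rfl⟩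
  · simp only at h1 h2 h3
    subst h3
    obtain ⟨i, rfl⟩ := Nat.exists_eq_succ_of_ne_zero h1.ne'
    exact Or.inr ⟨⟨i, h2⟩, rfl⟩

/-- The boxes of a hook, split into the first row and the leg. -/
def boxEquiv (hk : 1 ≤ k) (hkn : k ≤ n) :
    Fin k ⊕ Fin (n - k) ≃ Box (hook n k hk hkn) :=
  Equiv.ofBijective (Sum.elim (armBox hk hkn) (legBox hk hkn)) (by
    constructor
    · rintro (j | i) (j' | i') h <;>
        simp [armBox, legBox, Subtype.ext_iff, Fin.ext_iff] at h ⊢ <;> omega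
    · intro b
      rcases box_cases b with ⟨j, rfl⟩ | ⟨i, rfl⟩
      · exact ⟨Sum.inl j, rfl⟩
      · exact ⟨Sum.inr i, rfl⟩)

variable {P : Type*} [PartialOrder P] {hk : 1 ≤ k} {hkn : k ≤ n}

/-- The first row of a tableau of hook shape. -/
def rowEntries (T : PTableau P (hook n k hk hkn)) : List P := List.ofFn fun j => T (armBox hk hkn j)

/-- The entries of the first column of a tableau of hook shape below the first row. -/
def legEntries (T : PTableau P (hook n k hk hkn)) : List P := List.ofFn fun i => T (legBox hk hkn i)

/-- Only the first row and the first column of a hook contain adjacent boxes. -/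
theorem isStandard_hook_iff {T : PTableau P (hook n k hk hkn)} :
    IsStandard T ↔ ((rowEntries T).IsChain fun a b => ¬ b < a) ∧
      (T (armBox hk hkn ⟨0, hk⟩) :: legEntries T).IsChain (· < ·) := by
  have hleg : (T (armBox hk hkn ⟨0, hk⟩) :: legEntries T) = List.ofFn
      (Fin.cons (T (armBox hk hkn ⟨0, hk⟩)) fun i => T (legBox hk hkn i) :
        Fin (n - k + 1) → P) := by
    rw [List.ofFn_cons]; rfl
  rw [hleg, rowEntries, List.isChain_ofFn, List.isChain_ofFn, IsStandard, and_comm]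
  refine and_congr ⟨fun h j hj => ?_, fun h b b' h1 h2 => ?_⟩ ⟨fun h i hi => ?_, fun h b b' h1 h2 => ?_⟩
  · exact h (armBox hk hkn ⟨j, by omega⟩) (armBox hk hkn ⟨j + 1, hj⟩) rfl rfl
  · rcases box_cases b with ⟨j, rfl⟩ | ⟨i, rfl⟩ <;> rcases box_cases b' with ⟨j', rfl⟩ | ⟨i', rfl⟩
    · have h2' : (j' : ℕ) = j + 1 := h2
      have := h j (by omega)
      have e : j' = ⟨j + 1, by omega⟩ := Fin.ext h2'
      rw [e]
      exact this
    · exact absurd h1 (Nat.succ_ne_zero _)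
    · exact absurd h1.symm (Nat.succ_ne_zero _)
    · exact absurd h2.symm (Nat.succ_ne_zero _)
  · cases i with
    | zero => exact h (armBox hk hkn ⟨0, hk⟩) (legBox hk hkn ⟨0, by omega⟩) rfl rfl
    | succ i =>
      exact h (legBox hk hkn ⟨i, by omega⟩) (legBox hk hkn ⟨i + 1, by omega⟩) rfl rfl
  · rcases box_cases b with ⟨j, rfl⟩ | ⟨i, rfl⟩ <;> rcases box_cases b' with ⟨j', rfl⟩ | ⟨i', rfl⟩
    · exact absurd h1.symm (Nat.succ_ne_zero _)
    · have h2' : 0 = (j : ℕ) := h2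
      have h1' : (i' : ℕ) + 1 = 0 + 1 := h1
      have := h 0 (by have := i'.2; omega)
      have e : j = ⟨0, hk⟩ := Fin.ext h2'.symm
      have e' : i' = ⟨0, by have := i'.2; omega⟩ := Fin.ext (by simpa using h1')
      rw [e, e']
      exact this
    · exact absurd h1.symm (Nat.succ_ne_zero _)
    · have h1' : (i' : ℕ) + 1 = (i + 1) + 1 := h1
      have := h (i + 1) (by have := i'.2; omega)
      have e' : i' = ⟨i + 1, by have := i'.2; omega⟩ := Fin.ext (by simpa using h1')
      rw [e']
      exact this

variable [DecidableEq P] [Fintype P]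

theorem isStandard_iff_mem_hookPairs {T : PTableau P (hook n k hk hkn)} :
    IsStandard T ↔ (rowEntries T, legEntries T) ∈ hookPairs Finset.univ (n - k) := by
  have hrow : ∃ l, rowEntries T = T (armBox hk hkn ⟨0, hk⟩) :: l := by
    obtain ⟨k, rfl⟩ := Nat.exists_eq_add_of_le' hk
    exact ⟨_, List.ofFn_succ⟩
  rw [isStandard_hook_iff]
  constructor
  · rintro ⟨h1, h2⟩
    obtain ⟨l, hl⟩ := hrow
    refine ⟨⟨?_, ?_, by simp [legEntries], h1, h2.tail⟩, _, l, hl, h2⟩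
    · rw [List.nodup_append]
      refine ⟨List.nodup_ofFn.2 ?_, List.nodup_ofFn.2 ?_, ?_⟩
      · intro j j' h
        have := (boxEquiv hk hkn).injective (a₁ := Sum.inl j) (a₂ := Sum.inl j') (T.injective h)
        exact Sum.inl_injective this
      · intro i i' h
        have := (boxEquiv hk hkn).injective (a₁ := Sum.inr i) (a₂ := Sum.inr i') (T.injective h)
        exact Sum.inr_injective this
      · intro x hx y hy hxy
        obtain ⟨j, rfl⟩ := List.mem_ofFn.1 hx
        obtain ⟨i, rfl⟩ := List.mem_ofFn.1 hy
        have := (boxEquiv hk hkn).injective (a₁ := Sum.inl j) (a₂ := Sum.inr i) (T.injective hxy)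
        exact Sum.inl_ne_inr this
    · ext p
      simp only [List.toFinset_append, Finset.mem_union, List.mem_toFinset, Finset.mem_univ,
        iff_true]
      obtain ⟨b, rfl⟩ := T.surjective p
      rcases box_cases b with ⟨j, rfl⟩ | ⟨i, rfl⟩
      · exact Or.inl (List.mem_ofFn.2 ⟨j, rfl⟩)
      · exact Or.inr (List.mem_ofFn.2 ⟨i, rfl⟩)
  · rintro ⟨⟨-, -, -, h1, -⟩, a, l, h2, h3⟩
    obtain ⟨l', hl'⟩ := hrow
    simp only at h1 h2 h3
    rw [hl', List.cons.injEq] at h2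
    rw [h2.1]
    exact ⟨h1, h3⟩

theorem exists_tableau (hP : Fintype.card P = n) {l m : List P}
    (h : (l, m) ∈ listPairs (Finset.univ : Finset P) (n - k)) :
    ∃ T : PTableau P (hook n k hk hkn), rowEntries T = l ∧ legEntries T = m := by
  have hlen := card_eq_of_mem_listPairs h
  rw [Finset.card_univ, hP] at hlen
  obtain ⟨h1, h2, h3, -, -⟩ := h
  simp only at h1 h2 h3
  -- The two lists together have n entries and the leg has n - k of them.
  obtain rfl : l.length = k := by omega
  rw [List.nodup_append] at h1
  have hbij : Function.Bijective (Sum.elim l.get fun i : Fin (n - l.length) =>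
      m.get ⟨i, by omega⟩) := by
    constructor
    · rintro (j | i) (j' | i') h
      · exact congrArg _ (h1.1.injective_get h)
      · exact absurd h (h1.2.2 _ (List.get_mem _ _) _ (List.get_mem _ _))
      · exact absurd h.symm (h1.2.2 _ (List.get_mem _ _) _ (List.get_mem _ _))
      · have := h1.2.1.injective_get h
        exact congrArg _ (Fin.ext (Fin.mk.inj this))
    · intro p
      have hp : p ∈ (l ++ m).toFinset := h2 ▸ Finset.mem_univ p
      rw [List.mem_toFinset, List.mem_append] at hp
      rcases hp with hp | hp
      · obtain ⟨j, hj⟩ := List.get_of_mem hp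
        exact ⟨Sum.inl j, hj⟩
      · obtain ⟨i, hi, hi'⟩ := List.getElem_of_mem hp
        exact ⟨Sum.inr ⟨i, by omega⟩, hi'⟩
  refine ⟨(boxEquiv hk hkn).symm.trans (Equiv.ofBijective _ hbij), ?_, ?_⟩
  · refine (List.ofFn_inj.2 (funext fun j => ?_)).trans (List.ofFn_get l)
    have : armBox hk hkn j = boxEquiv hk hkn (Sum.inl j) := rfl
    rw [this, Equiv.trans_apply, Equiv.symm_apply_apply]
    rfl
  · refine List.ext_getElem (by simp [legEntries, h3]) fun i hi hi' => ?_
    simp only [legEntries, List.getElem_ofFn]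
    have : ∀ i, legBox hk hkn i = boxEquiv hk hkn (Sum.inr i) := fun _ => rfl
    rw [this, Equiv.trans_apply, Equiv.symm_apply_apply]
    rfl

theorem card_markedTableau (hP : Fintype.card P = n) :
    Nat.card (MarkedTableau P (hook n k hk hkn)) =
      (incomparablyMarked (Finset.univ : Finset P) (n - k)).ncard := by
  rw [← Nat.card_coe_set_eq]
  have hsplit : ∀ (T : PTableau P (hook n k hk hkn)) (j : Fin k),
      (rowEntries T).take j ++ T (armBox hk hkn j) :: (rowEntries T).drop (j + 1) =
        rowEntries T := by
    intro T j
    have hj : (j : ℕ) < (rowEntries T).length := by simp [rowEntries]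
    have : T (armBox hk hkn j) = (rowEntries T)[(j : ℕ)] := by simp [rowEntries]
    rw [this, ← List.drop_eq_getElem_cons hj, List.take_append_drop]
  have htake : ∀ (T : PTableau P (hook n k hk hkn)) (j : Fin k) p,
      p ∈ (rowEntries T).take j ++ legEntries T ↔ (∃ j' : Fin k, j' < j ∧ T (armBox hk hkn j') = p) ∨
        ∃ i, T (legBox hk hkn i) = p := by
    intro T j p
    rw [List.mem_append, legEntries, List.mem_ofFn, List.mem_take_iff_getElem]
    refine or_congr_left ⟨?_, ?_⟩
    · rintro ⟨j', hj', rfl⟩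
      have hj'' : j' < k := by have := j.2; omega
      exact ⟨⟨j', hj''⟩, by rw [Fin.lt_def]; simp only; omega, by simp [rowEntries]⟩
    · rintro ⟨j', hj', rfl⟩
      exact ⟨j', by simp [rowEntries]; exact hj', by simp [rowEntries]⟩
  let f : MarkedTableau P (hook n k hk hkn) → List P × P × List P × List P := fun z =>
    ((rowEntries z.1.1).take z.1.2.1.2, z.1.1 z.1.2, (rowEntries z.1.1).drop (z.1.2.1.2 + 1),
      legEntries z.1.1)
  have hcol : ∀ (b : Box (hook n k hk hkn)), b.1.1 = 0 → ∃ j, b = armBox hk hkn j := by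
    intro b hb
    rcases box_cases b with h | ⟨i, rfl⟩
    · exact h
    · exact absurd hb (Nat.succ_ne_zero _)
  have hf : ∀ z, f z ∈ incomparablyMarked (Finset.univ : Finset P) (n - k) := by
    rintro ⟨⟨T, b⟩, hT, hb, b', hb', hinc⟩
    simp only at hT hb hb' hinc
    obtain ⟨j, rfl⟩ := hcol b hb
    -- The corner has no earlier column, so it is never the marked entry.
    have hj0 : 0 < (j : ℕ) := lt_of_le_of_lt (Nat.zero_le _) hb'
    refine ⟨⟨?_, ?_⟩, T b', ?_, hinc⟩
    · change (rowEntries T).take j ≠ []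
      rw [ne_eq, List.take_eq_nil_iff]
      rintro (h | h)
      · omega
      · have := congrArg List.length h
        simp [rowEntries] at this
        omega
    · change ((rowEntries T).take j ++ T (armBox hk hkn j) :: (rowEntries T).drop (j + 1),
        legEntries T) ∈ _
      rw [hsplit]
      exact isStandard_iff_mem_hookPairs.1 hT
    · refine (htake T j _).2 ?_
      rcases box_cases b' with ⟨j', rfl⟩ | ⟨i, rfl⟩
      · exact Or.inl ⟨j', hb', rfl⟩
      · exact Or.inr ⟨i, rfl⟩
  refine Nat.card_congr (Equiv.ofBijective (fun z => ⟨f z, hf z⟩) ⟨?_, ?_⟩)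
  · rintro ⟨⟨T, b⟩, hT, hb, hm⟩ ⟨⟨T', b'⟩, hT', hb', hm'⟩ h
    obtain ⟨j, rfl⟩ := hcol b hb
    obtain ⟨j', rfl⟩ := hcol b' hb'
    have h' := Subtype.ext_iff.1 h
    simp only [f, Prod.mk.injEq] at h'
    obtain ⟨e1, e2, e3, e4⟩ := h'
    have hrow : rowEntries T = rowEntries T' := by
      rw [← hsplit T j, ← hsplit T' j']
      exact congrArg₂ _ e1 (congrArg₂ _ e2 e3)
    have hTT : T = T' := by
      refine Equiv.ext fun b => ?_
      rcases box_cases b with ⟨j, rfl⟩ | ⟨i, rfl⟩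
      · exact congrFun (List.ofFn_injective hrow) j
      · exact congrFun (List.ofFn_injective e4) i
    subst hTT
    have hjj : armBox hk hkn j = armBox hk hkn j' := T.injective e2
    exact Subtype.ext (Prod.ext rfl hjj)
  · rintro ⟨⟨l₁, x, l₂, c⟩, ⟨hne, hmem⟩, y, hy, hinc⟩
    simp only at hne hmem hy hinc
    obtain ⟨T, hT1, hT2⟩ := exists_tableau (hk := hk) (hkn := hkn) hP hmem.1
    have hlen : l₁.length < k := by
      have := congrArg List.length hT1
      simp [rowEntries] at this
      omega
    let j : Fin k := ⟨l₁.length, hlen⟩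
    have htk : (rowEntries T).take j = l₁ := by simp [hT1, j]
    have hdr : (rowEntries T).drop (j + 1) = l₂ := by simp [hT1, j]
    have hx : T (armBox hk hkn j) = x := by
      have := hsplit T j
      rw [htk, hdr, hT1] at this
      have := List.append_cancel_left this
      exact (List.cons.inj this).1
    have hst : IsStandard T := isStandard_iff_mem_hookPairs.2 (by rw [hT1, hT2]; exact hmem)
    have hy' := (htake T j y).1 (by rw [htk, hT2]; exact hy)
    have hmark : ∃ b' : Box (hook n k hk hkn), b'.1.2 < (armBox hk hkn j).1.2 ∧
        IncompRel (· ≤ ·) (T b') (T (armBox hk hkn j)) := by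
      rw [hx]
      rcases hy' with ⟨j', hj', rfl⟩ | ⟨i, rfl⟩
      · exact ⟨_, hj', hinc⟩
      -- Leg boxes lie in column 0, which is earlier than the marked column because `l₁` is
      -- nonempty.
      · exact ⟨_, List.length_pos_iff.2 hne, hinc⟩
    refine ⟨⟨(T, armBox hk hkn j), hst, rfl, hmark⟩, Subtype.ext ?_⟩
    simp only [f]
    exact Prod.ext htk (Prod.ext hx (Prod.ext hdr hT2))

end HookTableaux

end ChromTrace
end

/-! ### The inequality between neighbouring hooks -/

theorem lemmal {P : Type*} [PartialOrder P] (n : ℕ) (lab : P ≃ Fin n) (hlab : StrictMono lab)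
    (k : ℕ) (hk : 2 ≤ k) (hkn : k ≤ n) :
    ∃ a b : ℚ,
      ChromTrace.HasEval (ChromTrace.irrChar (ChromTrace.hook n k (by omega) hkn))
        (ChromTrace.incGraph P) a ∧
      ChromTrace.HasEval (ChromTrace.irrChar (ChromTrace.hook n (k - 1) (by omega) (by omega)))
        (ChromTrace.incGraph P) b ∧
      ((k : ℚ) - 1) * a ≥ ((n : ℚ) - k + 1) * b ∧
      ((k : ℚ) - 1) * a - ((n : ℚ) - k + 1) * b =
        (Nat.card (ChromTrace.MarkedTableau P (ChromTrace.hook n k (by omega) hkn)) : ℚ) := by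
  classical
  have : Fintype P := Fintype.ofEquiv (Fin n) lab.symm
  have hP : Fintype.card P = n := by rw [Fintype.card_congr lab, Fintype.card_fin]
  have hex : ∃ D : ChromTrace.GroupAlg n,
      ChromTrace.symmGen D = ChromTrace.chromSymm n (ChromTrace.incGraph P) := by
    obtain ⟨D, hD⟩ := ChromTrace.exists_evalAlg_epsilonChar
      fun μ : n.Partition => (ChromTrace.numColorings (ChromTrace.incGraph P) μ : ℚ)
    exact ⟨D, ChromTrace.symmGen_eq_chromSymm_iff.2 hD⟩
  -- The first row has k entries, of which k - 1 lie outside the corner; the leg has n - k.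
  have hcount := ChromTrace.ncard_incomparablyMarked (T := (Finset.univ : Finset P)) (i := n - k)
    (k := k - 1) (by rw [Finset.card_univ, hP]; omega)
  have hdiff : ((k : ℚ) - 1) * (ChromTrace.hookPairs (Finset.univ : Finset P) (n - k)).ncard -
      ((n : ℚ) - k + 1) * (ChromTrace.hookPairs (Finset.univ : Finset P) (n - (k - 1))).ncard =
      (Nat.card (ChromTrace.MarkedTableau P (ChromTrace.hook n k (by omega) hkn)) : ℚ) := by
    rw [ChromTrace.card_markedTableau hP, show n - (k - 1) = n - k + 1 by omega]
    have h := congrArg (Nat.cast : ℕ → ℚ) hcount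
    push_cast [Nat.cast_sub (by omega : 1 ≤ k), Nat.cast_sub hkn] at h
    linear_combination h
  refine ⟨_, _, ⟨hex, fun D hD => ChromTrace.evalAlg_irrChar_hook hP hD _ _⟩,
    ⟨hex, fun D hD => ChromTrace.evalAlg_irrChar_hook hP hD _ _⟩, ?_, hdiff⟩
  rw [ge_iff_le, ← sub_nonneg, hdiff]
  exact Nat.cast_nonneg _
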